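/- Let $0<m_0\le\beta<\infty$. For $b>0$ let $\mathcal P([0,b])$ be the set of Borel probability distributions on $[0,b]$, with the $1$-Wasserstein distance $d_W(\xi_1,\xi_2)=\int_0^b|F_{\xi_1}(t)-F_{\xi_2}(t)|\,dt$ ($F_\xi$ the distribution function of $\xi$), which metrizes weak convergence. Let $\boldsymbol{\mathcal P}$ be the set of pairs $(\mu,\nu)\in\mathcal P([0,\beta])^2$ with $\int k\,\mu(dk)=\int k\,\nu(dk)\ge m_0$, with the distance $d_M((\mu_1,\nu_1),(\mu_2,\nu_2))=d_W(\mu_1,\mu_2)+d_W(\nu_1,\nu_2)$. Let $\mathbb S=[0,\infty)^2\setminus\{(0,0)\}$, let $C(\mathbb S,\mathcal P([0,1]))$ be the set of continuous maps $\mathbb S\to\mathcal P([0,1])$, and put $$d(G_1,G_2)=\sum_{n=1}^\infty 2^{-n}\frac{d_n(G_1,G_2)}{1+d_n(G_1,G_2)},\qquad d_n(G_1,G_2)=\sup_{(x,y)\in\mathbb S,\;x+y\ge 1/n}d_W(G_1(x,y),G_2(x,y)).$$ On a probability space let $(U_n)_{n\ge1}$ and $((V_n,W_n))_{n\ge1}$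 be independent sequences, the first i.i.d. uniform on $[0,1]$, the second i.i.d. with both components uniform on $[0,1]$. For $(\mu,\nu)\in\boldsymbol{\mathcal P}$ and $(x,y)\in\mathbb S$, the randomly reinforced urn with initial composition $(x,y)$ and reinforcement distributions $\mu,\nu$ is the process $(X_0,Y_0)=(x,y)$, $$X_{n+1}=X_n+q_\mu(V_{n+1})\,\mathbb I(n+1),\qquad Y_{n+1}=Y_n+q_\nu(W_{n+1})\,(1-\mathbb I(n+1)),$$ where $q_\xi$ is the quantile function of $\xi$ and $\mathbb I(n+1)$ is the indicator of $\{U_{n+1}\le X_n/(X_n+Y_n)\}$. Then for all $(\mu,\nu)\in\boldsymbol{\mathcal P}$ and $(x,y)\in\mathbb S$ the proportion $Z_n=X_n/(X_n+Y_n)$ converges almost surely to a $[0,1]$-valued random variable $Z_\infty(x,y)$, whose distribution $F_{(\mu,\nu)}(x,y)$ does not depend on the choice of the probability space and of the two sequences; the map $F_{(\mu,\nu)}$ belongs to $C(\mathbb S,\mathcal P([0,1]))$; and the map $$(\mu,\nu)\mapsto F_{(\mu,\nu)},\qquad(\boldsymbol{\mathcal P},d_M)\to(C(\mathbb S,\mathcal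 P([0,1])),d),$$ is uniformly continuous. -/

import Mathlib

open MeasureTheory ProbabilityTheory Filter Topology

universe u

namespace RRU

noncomputable section

/-! ### Distributions on `[0, β]` and the 1-Wasserstein distance -/

/-- `𝒫([0, β])`, the Borel probability distributions on the real interval `[0, β]`. -/
abbrev Distr (β : ℝ) : Type := ProbabilityMeasure (Set.Icc (0 : ℝ) β)

/-- The cumulative distribution function `F_ξ(t) = ξ([0, t])`. -/
def distrFun {β : ℝ} (ξ : Distr β) (t : ℝ) : ℝ :=
  (ξ : Measure (Set.Icc (0 : ℝ) β)).real {k | (k : ℝ) ≤ t}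

/-- The quantile function `q_ξ(t) = inf {z ∈ [0, β] : F_ξ(z) ≥ t}`, for `t ∈ [0, 1]`. -/
def quantile {β : ℝ} (ξ : Distr β) (t : Set.Icc (0 : ℝ) 1) : ℝ :=
  sInf {z : ℝ | z ∈ Set.Icc (0 : ℝ) β ∧ (t : ℝ) ≤ distrFun ξ z}

/-- The 1-Wasserstein distance `d_W(ξ₁, ξ₂) = ∫₀^β |F_{ξ₁}(t) - F_{ξ₂}(t)| dt`. -/
def dW {β : ℝ} (ξ₁ ξ₂ : Distr β) : ℝ :=
  ∫ t in (0 : ℝ)..β, |distrFun ξ₁ t - distrFun ξ₂ t|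

/-- The mean `∫ k ξ(dk)`. -/
def mean {β : ℝ} (ξ : Distr β) : ℝ :=
  ∫ k, (k : ℝ) ∂(ξ : Measure (Set.Icc (0 : ℝ) β))

/-! ### The set of parameters -/

/-- The parameters: pairs `(μ, ν)` of distributions on `[0, β]` with equal means, at least `m₀`. -/
def Params (m₀ β : ℝ) : Type :=
  {p : Distr β × Distr β // mean p.1 = mean p.2 ∧ m₀ ≤ mean p.1}

/-- The Manhattan distance `d_M((μ₁, ν₁), (μ₂, ν₂)) = d_W(μ₁, μ₂) + d_W(ν₁, ν₂)`. -/
def dM {m₀ β : ℝ} (p q : Params m₀ β) : ℝ :=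
  dW p.1.1 q.1.1 + dW p.1.2 q.1.2

/-! ### The space `C(𝕊, 𝒫([0, 1]))` and its distance -/

/-- `𝕊 = [0, ∞) × [0, ∞) ∖ {(0, 0)}`. -/
def Quadrant : Set (ℝ × ℝ) := (Set.Ici 0 ×ˢ Set.Ici 0) \ {(0, 0)}

/-- `C(𝕊, 𝒫([0, 1]))`; the topology on `𝒫([0, 1])` is that of weak convergence, which is the one
induced by `dW`. -/
abbrev Maps : Type := C(Quadrant, Distr 1)

/-- `d_n(G₁, G₂)`, the supremum of `d_W(G₁(x, y), G₂(x, y))` over the `(x, y) ∈ 𝕊` with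
`x + y ≥ 1 / n`. -/
def dTrunc (n : ℕ) (G₁ G₂ : Maps) : ℝ :=
  ⨆ s : {s : Quadrant // 1 / (n : ℝ) ≤ s.1.1 + s.1.2}, dW (G₁ s.1) (G₂ s.1)

/-- `d(G₁, G₂) = ∑_{n ≥ 1} 2⁻ⁿ d_n(G₁, G₂) / (1 + d_n(G₁, G₂))`. -/
def dMaps (G₁ G₂ : Maps) : ℝ :=
  ∑' n : ℕ, 1 / (2 : ℝ) ^ (n + 1) * (dTrunc (n + 1) G₁ G₂ / (1 + dTrunc (n + 1) G₁ G₂))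

/-! ### The randomly reinforced urn -/

/-- The random input of the urn: independent sequences `(Uₙ)` and `((Vₙ, Wₙ))`, the first one
i.i.d. uniform on `[0, 1]`, the second one i.i.d. with both components uniform on `[0, 1]`
(`Vₙ` and `Wₙ` may depend on each other). The index `n` here is `n + 1` in the usual numbering
from one. -/
structure IsUrnInput {Ω : Type u} [MeasurableSpace Ω] (P : Measure Ω)
    (U V W : ℕ → Ω → Set.Icc (0 : ℝ) 1) : Prop where
  measurable_U : ∀ n, Measurable (U n)
  measurable_V : ∀ n, Measurable (V n)
  measurable_W : ∀ n, Measurable (W n)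
  map_U : ∀ n, P.map (U n) = volume
  map_V : ∀ n, P.map (V n) = volume
  map_W : ∀ n, P.map (W n) = volume
  identDistrib_VW : ∀ n, IdentDistrib (fun ω => (V n ω, W n ω)) (fun ω => (V 0 ω, W 0 ω)) P P
  iIndepFun_U : iIndepFun U P
  iIndepFun_VW : iIndepFun (fun n ω => (V n ω, W n ω)) P
  indepFun_U_VW : IndepFun (fun ω n => U n ω) (fun ω n => (V n ω, W n ω)) P

/-- The urn composition `(Xₙ, Yₙ)`, started from `(X₀, Y₀) = s`: on `{Uₙ₊₁ ≤ Xₙ / (Xₙ + Yₙ)}`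
the reinforcement `q_μ(Vₙ₊₁)` is added to `Xₙ`, otherwise `q_ν(Wₙ₊₁)` is added to `Yₙ`. -/
def urn {β : ℝ} {Ω : Type u} (μ ν : Distr β) (U V W : ℕ → Ω → Set.Icc (0 : ℝ) 1) (s : ℝ × ℝ) :
    ℕ → Ω → ℝ × ℝ
  | 0, _ => s
  | n + 1, ω =>
    let c := urn μ ν U V W s n ω
    if (U n ω : ℝ) ≤ c.1 / (c.1 + c.2) then (c.1 + quantile μ (V n ω), c.2)
    else (c.1, c.2 + quantile ν (W n ω))

/-- The proportion `Zₙ = Xₙ / (Xₙ + Yₙ)`. -/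
def proportion {β : ℝ} {Ω : Type u} (μ ν : Distr β) (U V W : ℕ → Ω → Set.Icc (0 : ℝ) 1)
    (s : ℝ × ℝ) (n : ℕ) (ω : Ω) : ℝ :=
  (urn μ ν U V W s n ω).1 / ((urn μ ν U V W s n ω).1 + (urn μ ν U V W s n ω).2)

/-- `π` is the distribution of the limit proportion: on every probability space carrying an urn
input, the proportions `Zₙ` converge almost surely to a `[0, 1]`-valued random variable `Z_∞`
with distribution `π`. -/
def IsLimitLaw {β : ℝ} (μ ν : Distr β) (s : ℝ × ℝ) (π : Distr 1) : Prop :=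
  ∀ (Ω : Type u) [MeasurableSpace Ω] (P : Measure Ω) [IsProbabilityMeasure P]
    (U V W : ℕ → Ω → Set.Icc (0 : ℝ) 1), IsUrnInput P U V W →
    ∃ Zlim : Ω → Set.Icc (0 : ℝ) 1, Measurable Zlim ∧
      (∀ᵐ ω ∂P, Tendsto (fun n => proportion μ ν U V W s n ω) atTop (𝓝 (Zlim ω : ℝ))) ∧
      P.map Zlim = (π : Measure (Set.Icc (0 : ℝ) 1))

/-- Urn inputs exist in every universe, so that `IsLimitLaw` determines the distribution. -/
theorem exists_isUrnInput :
    ∃ (Ω : Type u) (_ : MeasurableSpace Ω) (P : Measure Ω) (U V W : ℕ → Ω → Set.Icc (0 : ℝ) 1),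
      IsProbabilityMeasure P ∧ IsUrnInput P U V W := by
  let J := Set.Icc (0 : ℝ) 1
  let P₁ : Measure (ULift.{u} ℕ → J) := Measure.infinitePi (fun _ => (volume : Measure J))
  let P₂ : Measure (ULift.{u} ℕ → J × J) :=
    Measure.infinitePi (fun _ => (volume : Measure (J × J)))
  have e₁ : ∀ i, P₁.map (fun ω => ω i) = volume := fun i => Measure.infinitePi_map_eval _ i
  have e₂ : ∀ i, P₂.map (fun ω => ω i) = volume := fun i => Measure.infinitePi_map_eval _ i
  have f₁ : (P₁.prod P₂).map Prod.fst = P₁ := by simp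
  have f₂ : (P₁.prod P₂).map Prod.snd = P₂ := by simp
  have m₂ : ∀ n : ℕ, (P₁.prod P₂).map (fun ω => ω.2 ⟨n⟩) = volume := fun n => by
    rw [← e₂ ⟨n⟩, ← f₂, Measure.map_map (by fun_prop) (by fun_prop), f₂]; rfl
  have i₁ : iIndepFun (fun (n : ℕ) (ω : ULift.{u} ℕ → J) => ω ⟨n⟩) P₁ :=
    (iIndepFun_infinitePi (P := fun _ : ULift.{u} ℕ => (volume : Measure J))
      (X := fun _ x => x) (fun _ => measurable_id)).precomp ULift.up_injective
  have i₂ : iIndepFun (fun (n : ℕ) (ω : ULift.{u} ℕ → J × J) => ω ⟨n⟩) P₂ :=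
    (iIndepFun_infinitePi (P := fun _ : ULift.{u} ℕ => (volume : Measure (J × J)))
      (X := fun _ x => x) (fun _ => measurable_id)).precomp ULift.up_injective
  refine ⟨(ULift.{u} ℕ → J) × (ULift.{u} ℕ → J × J), inferInstance, P₁.prod P₂,
    fun n ω => ω.1 ⟨n⟩, fun n ω => (ω.2 ⟨n⟩).1, fun n ω => (ω.2 ⟨n⟩).2, inferInstance, ?_⟩
  refine ⟨fun n => by fun_prop, fun n => by fun_prop, fun n => by fun_prop, fun n => ?_,
    fun n => ?_, fun n => ?_, fun n => ?_, ?_, ?_, ?_⟩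
  · rw [← e₁ ⟨n⟩, ← f₁, Measure.map_map (by fun_prop) (by fun_prop), f₁]; rfl
  · have := congrArg (Measure.map Prod.fst) (m₂ n)
    rw [Measure.map_map (by fun_prop) (by fun_prop)] at this
    refine this.trans ?_
    rw [Measure.volume_eq_prod]; simp
  · have := congrArg (Measure.map Prod.snd) (m₂ n)
    rw [Measure.map_map (by fun_prop) (by fun_prop)] at this
    refine this.trans ?_
    rw [Measure.volume_eq_prod]; simp
  · exact ⟨by fun_prop, by fun_prop, (m₂ n).trans (m₂ 0).symm⟩
  · rw [iIndepFun_iff_measure_inter_preimage_eq_mul] at i₁ ⊢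
    intro S A hA
    have key : ∀ B : Set (ULift.{u} ℕ → J), MeasurableSet B →
        (P₁.prod P₂) (Prod.fst ⁻¹' B) = P₁ B := fun B hB => by
      rw [← Measure.map_apply measurable_fst hB, f₁]
    have hm : ∀ i ∈ S, MeasurableSet ((fun ω : ULift.{u} ℕ → J => ω ⟨i⟩) ⁻¹' A i) :=
      fun i hi => (measurable_pi_apply _) (hA i hi)
    have := i₁ S hA
    rw [← key _ (S.measurableSet_biInter hm), Set.preimage_iInter₂] at this
    refine this.trans (Finset.prod_congr rfl fun i hi => (key _ (hm i hi)).symm)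
  · change iIndepFun (fun (n : ℕ) (ω : (ULift.{u} ℕ → J) × (ULift.{u} ℕ → J × J)) => ω.2 ⟨n⟩) _
    rw [iIndepFun_iff_measure_inter_preimage_eq_mul] at i₂ ⊢
    intro S A hA
    have key : ∀ B : Set (ULift.{u} ℕ → J × J), MeasurableSet B →
        (P₁.prod P₂) (Prod.snd ⁻¹' B) = P₂ B := fun B hB => by
      rw [← Measure.map_apply measurable_snd hB, f₂]
    have hm : ∀ i ∈ S, MeasurableSet ((fun ω : ULift.{u} ℕ → J × J => ω ⟨i⟩) ⁻¹' A i) :=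
      fun i hi => (measurable_pi_apply _) (hA i hi)
    have := i₂ S hA
    rw [← key _ (S.measurableSet_biInter hm), Set.preimage_iInter₂] at this
    refine this.trans (Finset.prod_congr rfl fun i hi => (key _ (hm i hi)).symm)
  · exact indepFun_prod (X := fun (ω : ULift.{u} ℕ → J) (n : ℕ) => ω ⟨n⟩)
      (Y := fun (ω : ULift.{u} ℕ → J × J) (n : ℕ) => ω ⟨n⟩) (by fun_prop) (by fun_prop)

end

end RRU

/-! Write `Z` for the proportion and `T` for the total content. A draw that adds `R` changes `Z` by
`ζ R / (T + R)`, where `ζ` is `1 - Z` or `-Z` according to the colour. Its linearization `ζ R / T`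
has conditional mean zero because the two reinforcement means agree, and since `R ≤ β` the error is
at most `β (1 / T - 1 / (T + R))`. Thus the decrease of `1 / T` pays for both the drift and the
variance of `Z`. This is the inequality `lyapunov_step_le`, integrated in
`IsUrnInput.integral_lyapunov_nonpos`.

It is used twice. With the constant weight `-1` it makes `Z - 3β / T` a bounded submartingale, which
gives almost sure convergence (`IsUrnInput.exists_limit`). With weight `2 (Z_k - Z_n)` it telescopes
to `E (Z_m - Z_n)² ≤ 3β E (1 / T_n)` for `m ≥ n`. The lower bound `m₀` on the mean yields a
quadratic recursion for `E (1 / T_n)`, which therefore tends to zero at a rate depending only on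
`m₀`, `β` and a lower bound `t` for the initial content. Hence the proportions are Cauchy in `L¹`
uniformly in all the data (`exists_uniform_cauchy`), and the limit may be replaced by the proportion
at one fixed time `N`.

At a fixed time, urns driven by the same input are compared directly: quantile coupling makes
reinforcements differ on average by the Wasserstein distance, the common uniform makes the colours
differ with probability `E |Z - Z'|`, and the expected distance grows at most geometrically
(`IsUrnInput.integral_distL1_le`). The two estimates combine in `exists_uniform_close`, which gives
both the continuity in the initial composition and the uniform continuity in the parameters. The
metric on maps only requires uniformity on regions `x + y ≥ t`, because its tail is geometrically
small. -/

namespace RRU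

/-! ### Distribution functions and quantile functions -/

section Quantile

variable {β : ℝ}

lemma Distr.nonneg (ξ : Distr β) : 0 ≤ β := by
  obtain ⟨x⟩ := nonempty_of_isProbabilityMeasure (ξ : Measure (Set.Icc (0 : ℝ) β))
  exact x.2.1.trans x.2.2

lemma distrFun_mono (ξ : Distr β) : Monotone (distrFun ξ) := fun _ _ h =>
  measureReal_mono fun _ hk => le_trans hk h

lemma distrFun_nonneg (ξ : Distr β) (t : ℝ) : 0 ≤ distrFun ξ t := measureReal_nonneg

lemma distrFun_le_one (ξ : Distr β) (t : ℝ) : distrFun ξ t ≤ 1 := measureReal_le_one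

lemma distrFun_of_neg (ξ : Distr β) {t : ℝ} (ht : t < 0) : distrFun ξ t = 0 := by
  have : {k : Set.Icc (0 : ℝ) β | (k : ℝ) ≤ t} = ∅ := by
    ext k; simpa using ht.trans_le k.2.1
  simp [distrFun, this]

lemma distrFun_of_le (ξ : Distr β) {t : ℝ} (ht : β ≤ t) : distrFun ξ t = 1 := by
  have : {k : Set.Icc (0 : ℝ) β | (k : ℝ) ≤ t} = Set.univ := by
    ext k; simpa using k.2.2.trans ht
  simp [distrFun, this]

lemma distrFun_eq_cdf (ξ : Distr β) (t : ℝ) :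
    distrFun ξ t = cdf ((ξ : Measure (Set.Icc (0 : ℝ) β)).map Subtype.val) t := by
  have : IsProbabilityMeasure ((ξ : Measure (Set.Icc (0 : ℝ) β)).map Subtype.val) :=
    Measure.isProbabilityMeasure_map measurable_subtype_coe.aemeasurable
  rw [cdf_eq_real, measureReal_def, Measure.map_apply measurable_subtype_coe measurableSet_Iic]
  rfl

lemma bddBelow_quantile_set (ξ : Distr β) (t : ℝ) :
    BddBelow {z : ℝ | z ∈ Set.Icc (0 : ℝ) β ∧ t ≤ distrFun ξ z} := ⟨0, fun _ hz => hz.1.1⟩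

lemma right_mem_quantile_set (ξ : Distr β) (t : Set.Icc (0 : ℝ) 1) :
    β ∈ {z : ℝ | z ∈ Set.Icc (0 : ℝ) β ∧ (t : ℝ) ≤ distrFun ξ z} :=
  ⟨⟨ξ.nonneg, le_rfl⟩, by rw [distrFun_of_le ξ le_rfl]; exact t.2.2⟩

lemma quantile_nonneg (ξ : Distr β) (t : Set.Icc (0 : ℝ) 1) : 0 ≤ quantile ξ t :=
  le_csInf ⟨β, right_mem_quantile_set ξ t⟩ fun _ hz => hz.1.1

lemma quantile_le (ξ : Distr β) (t : Set.Icc (0 : ℝ) 1) : quantile ξ t ≤ β :=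
  csInf_le (bddBelow_quantile_set ξ t) (right_mem_quantile_set ξ t)

/-- Right-continuity of the distribution function shows that the infimum defining the quantile still
satisfies the defining inequality. The condition `0 ≤ z` matters: at `t = 0` the right side holds
for negative `z` too. -/
lemma quantile_le_iff (ξ : Distr β) (t : Set.Icc (0 : ℝ) 1) {z : ℝ} (hz : 0 ≤ z) :
    quantile ξ t ≤ z ↔ (t : ℝ) ≤ distrFun ξ z := by
  rcases le_total β z with h | h
  · exact ⟨fun _ => by rw [distrFun_of_le ξ h]; exact t.2.2, fun _ => (quantile_le ξ t).trans h⟩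
  refine ⟨fun hq => ?_, fun ht => csInf_le (bddBelow_quantile_set ξ t) ⟨⟨hz, h⟩, ht⟩⟩
  have hr : Tendsto (distrFun ξ) (𝓝[>] z) (𝓝 (distrFun ξ z)) := by
    simp_rw [funext (distrFun_eq_cdf ξ)]
    exact ((cdf _).right_continuous z).mono Set.Ioi_subset_Ici_self
  refine ge_of_tendsto hr ?_
  filter_upwards [self_mem_nhdsWithin] with y hy
  obtain ⟨x, hx, hxy⟩ := exists_lt_of_csInf_lt ⟨β, right_mem_quantile_set ξ t⟩
    (hq.trans_lt hy)
  exact hx.2.trans (distrFun_mono ξ hxy.le)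

lemma measurable_quantile (ξ : Distr β) : Measurable (quantile ξ) := by
  refine Monotone.measurable fun s t hst => ?_
  exact csInf_le_csInf (bddBelow_quantile_set ξ s) ⟨β, right_mem_quantile_set ξ t⟩
    fun z hz => ⟨hz.1, le_trans hst hz.2⟩

lemma volume_real_coe_le {c : ℝ} (h0 : 0 ≤ c) (h1 : c ≤ 1) :
    (volume : Measure (Set.Icc (0 : ℝ) 1)).real {v | (v : ℝ) ≤ c} = c := by
  have : {v : Set.Icc (0 : ℝ) 1 | (v : ℝ) ≤ c} = Set.Iic ⟨c, h0, h1⟩ := rfl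
  rw [this, measureReal_def, unitInterval.volume_Iic]
  exact ENNReal.toReal_ofReal h0

lemma volume_real_quantile_le (ξ : Distr β) (t : ℝ) :
    (volume : Measure (Set.Icc (0 : ℝ) 1)).real {v | quantile ξ v ≤ t} = distrFun ξ t := by
  rcases lt_or_ge t 0 with h | h
  · have : {v | quantile ξ v ≤ t} = ∅ := by
      ext v; simpa using h.trans_le (quantile_nonneg ξ v)
    simp [this, distrFun_of_neg ξ h]
  · simp_rw [quantile_le_iff ξ _ h]
    exact volume_real_coe_le (distrFun_nonneg ξ t) (distrFun_le_one ξ t)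

/-- Inverse transform sampling, checked on half-lines. -/
lemma map_quantile (ξ : Distr β) :
    (volume : Measure (Set.Icc (0 : ℝ) 1)).map (quantile ξ) =
      (ξ : Measure (Set.Icc (0 : ℝ) β)).map Subtype.val := by
  have := Measure.isProbabilityMeasure_map (μ := (volume : Measure (Set.Icc (0 : ℝ) 1)))
    (measurable_quantile ξ).aemeasurable
  have := Measure.isProbabilityMeasure_map (μ := (ξ : Measure (Set.Icc (0 : ℝ) β)))
    (measurable_subtype_coe (p := (· ∈ Set.Icc (0 : ℝ) β))).aemeasurable
  refine Measure.ext_of_Iic _ _ fun a => ?_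
  rw [Measure.map_apply (measurable_quantile ξ) measurableSet_Iic,
    Measure.map_apply measurable_subtype_coe measurableSet_Iic,
    ← ENNReal.toReal_eq_toReal_iff' (measure_ne_top _ _) (measure_ne_top _ _)]
  exact volume_real_quantile_le ξ a

lemma integral_quantile (ξ : Distr β) : ∫ v, quantile ξ v = mean ξ := by
  have h := integral_map (μ := (volume : Measure (Set.Icc (0 : ℝ) 1)))
    (measurable_quantile ξ).aemeasurable (f := id) measurable_id.aestronglyMeasurable
  rw [map_quantile, integral_map measurable_subtype_coe.aemeasurable
    measurable_id.aestronglyMeasurable] at h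
  exact h.symm

end Quantile

/-! ### Couplings and the Wasserstein distance -/

section Wasserstein

variable {β : ℝ} {Ω : Type*} [MeasurableSpace Ω]

/-- For `a ≤ b` the two indicators differ exactly on `[a, b)`, whose length is `b - a`. -/
lemma abs_sub_eq_integral_indicator {a b : ℝ} (ha : a ∈ Set.Icc 0 β) (hb : b ∈ Set.Icc 0 β) :
    |a - b| = ∫ t in (0 : ℝ)..β, |(Set.Ici a).indicator 1 t - (Set.Ici b).indicator 1 t| := by
  wlog hab : a ≤ b generalizing a b
  · rw [abs_sub_comm, this hb ha (le_of_not_ge hab)]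
    simp_rw [abs_sub_comm]
  have h : (fun t => |(Set.Ici a).indicator (1 : ℝ → ℝ) t - (Set.Ici b).indicator 1 t|) =
      (Set.Ico a b).indicator 1 := by
    ext t
    by_cases h1 : a ≤ t <;> by_cases h2 : b ≤ t <;> simp [Set.indicator, h1, h2]
    linarith
  have hs : Set.Icc 0 β ∩ Set.Ico a b = Set.Ico a b :=
    Set.inter_eq_right.2 fun t ht => ⟨ha.1.trans ht.1, ht.2.le.trans hb.2⟩
  rw [h, intervalIntegral.integral_of_le (ha.1.trans ha.2),
    ← integral_Icc_eq_integral_Ioc, setIntegral_indicator measurableSet_Ico, hs]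
  simp only [Pi.one_apply, integral_const, MeasurableSet.univ, measureReal_restrict_apply,
    Set.univ_inter, Real.volume_real_Ico_of_le hab, smul_eq_mul, mul_one]
  rw [abs_of_nonpos (by linarith)]; ring

/-- Fubini applied to the preceding pointwise identity. It reduces transport costs to comparing the
events `{A ≤ t}` and `{B ≤ t}` for each level `t`. -/
lemma integral_abs_sub_eq (hβ : 0 ≤ β) (P : Measure Ω) [IsProbabilityMeasure P] {A B : Ω → ℝ}
    (hA : Measurable A) (hB : Measurable B) (hA' : ∀ ω, A ω ∈ Set.Icc 0 β)
    (hB' : ∀ ω, B ω ∈ Set.Icc 0 β) :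
    ∫ ω, |A ω - B ω| ∂P = ∫ t in (0 : ℝ)..β,
      ∫ ω, |{ω | A ω ≤ t}.indicator 1 ω - {ω | B ω ≤ t}.indicator 1 ω| ∂P := by
  have key : ∀ {A : Ω → ℝ}, Measurable A → Measurable fun p : Ω × ℝ =>
      {ω | A ω ≤ p.2}.indicator (1 : Ω → ℝ) p.1 := fun {A} hA =>
    (measurable_one.indicator (s := {p : Ω × ℝ | A p.1 ≤ p.2})
      (measurableSet_le (hA.comp measurable_fst) measurable_snd) : _)
  simp_rw [fun ω => abs_sub_eq_integral_indicator (hA' ω) (hB' ω),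
    intervalIntegral.integral_of_le hβ]
  rw [integral_integral_swap]
  · rfl
  · refine Integrable.of_bound (C := 1) ?_ (ae_of_all _ fun p => ?_)
    · exact (((key hA).sub (key hB)).abs).aestronglyMeasurable
    · simp only [Function.uncurry, Set.indicator, Real.norm_eq_abs, abs_abs]
      split_ifs <;> simp

lemma abs_measureReal_sub_le (P : Measure Ω) [IsProbabilityMeasure P] {A B : Set Ω}
    (hA : MeasurableSet A) (hB : MeasurableSet B) :
    |P.real A - P.real B| ≤ ∫ ω, |A.indicator 1 ω - B.indicator 1 ω| ∂P := by
  rw [← integral_indicator_one hA, ← integral_indicator_one hB, ← integral_sub]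
  · exact abs_integral_le_integral_abs
  · exact (integrable_const 1).indicator hA
  · exact (integrable_const 1).indicator hB

/-- Nested events turn the bound `abs_measureReal_sub_le` into an equality. This makes the quantile
coupling optimal, since sublevel sets of quantile functions are initial intervals; it also computes
how often two urns choose different colours. -/
lemma integral_abs_indicator_sub (P : Measure Ω) [IsProbabilityMeasure P] {A B : Set Ω}
    (hA : MeasurableSet A) (hB : MeasurableSet B) (h : A ⊆ B ∨ B ⊆ A) :
    ∫ ω, |A.indicator 1 ω - B.indicator 1 ω| ∂P = |P.real A - P.real B| := by
  wlog hAB : A ⊆ B generalizing A B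
  · rw [abs_sub_comm, ← this hB hA h.symm (h.resolve_left hAB)]
    simp_rw [abs_sub_comm]
  have : ∀ ω, |A.indicator (1 : Ω → ℝ) ω - B.indicator 1 ω| = B.indicator 1 ω - A.indicator 1 ω :=
    fun ω => by
    rw [abs_sub_comm, abs_of_nonneg]
    exact sub_nonneg.2 (Set.indicator_le_indicator_of_subset hAB (fun _ => zero_le_one) ω)
  simp_rw [this]
  rw [integral_sub ((integrable_const 1).indicator hB) ((integrable_const 1).indicator hA),
    integral_indicator_one hA, integral_indicator_one hB, abs_sub_comm, abs_of_nonneg]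
  exact sub_nonneg.2 (measureReal_mono hAB)

lemma intervalIntegrable_distrFun_sub (ξ₁ ξ₂ : Distr β) (a b : ℝ) :
    IntervalIntegrable (fun t => |distrFun ξ₁ t - distrFun ξ₂ t|) volume a b :=
  (((distrFun_mono ξ₁).intervalIntegrable).sub ((distrFun_mono ξ₂).intervalIntegrable)).abs

/-- A coupling bounds the Wasserstein distance. -/
lemma dW_le_integral_abs_sub (P : Measure Ω) [IsProbabilityMeasure P] {ξ₁ ξ₂ : Distr β}
    {A B : Ω → Set.Icc (0 : ℝ) β} (hA : Measurable A) (hB : Measurable B)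
    (h₁ : P.map A = (ξ₁ : Measure (Set.Icc (0 : ℝ) β)))
    (h₂ : P.map B = (ξ₂ : Measure (Set.Icc (0 : ℝ) β))) :
    dW ξ₁ ξ₂ ≤ ∫ ω, |(A ω : ℝ) - B ω| ∂P := by
  rw [integral_abs_sub_eq ξ₁.nonneg P hA.subtype_val hB.subtype_val (fun ω => (A ω).2)
    fun ω => (B ω).2]
  have hle : ∀ t, |distrFun ξ₁ t - distrFun ξ₂ t| ≤
      ∫ ω, |{ω | (A ω : ℝ) ≤ t}.indicator 1 ω - {ω | (B ω : ℝ) ≤ t}.indicator 1 ω| ∂P := by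
    intro t
    have hF : ∀ {ξ : Distr β} {A : Ω → Set.Icc (0 : ℝ) β}, Measurable A →
        P.map A = (ξ : Measure (Set.Icc (0 : ℝ) β)) → distrFun ξ t = P.real {ω | (A ω : ℝ) ≤ t} := by
      intro ξ A hA h
      rw [distrFun, ← h, map_measureReal_apply hA (measurableSet_le measurable_subtype_coe
        measurable_const)]
      rfl
    rw [hF hA h₁, hF hB h₂]
    exact abs_measureReal_sub_le P (measurableSet_le hA.subtype_val measurable_const)
      (measurableSet_le hB.subtype_val measurable_const)
  refine intervalIntegral.integral_mono_on ξ₁.nonneg (intervalIntegrable_distrFun_sub _ _ _ _) ?_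
    fun t _ => hle t
  have key : ∀ {A : Ω → Set.Icc (0 : ℝ) β}, Measurable A → Measurable fun p : ℝ × Ω =>
      {ω | (A ω : ℝ) ≤ p.1}.indicator (1 : Ω → ℝ) p.2 := fun {A} hA =>
    (measurable_one.indicator (s := {p : ℝ × Ω | (A p.2 : ℝ) ≤ p.1})
      (measurableSet_le (hA.subtype_val.comp measurable_snd) measurable_fst) : _)
  rw [intervalIntegrable_iff_integrableOn_Ioc_of_le ξ₁.nonneg]
  refine Integrable.of_bound (C := 1) ?_ (ae_of_all _ fun t => ?_)
  · exact ((((key hA).sub (key hB)).abs).stronglyMeasurable.integral_prod_right).aestronglyMeasurable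
  · refine (norm_integral_le_of_norm_le_const (C := 1) (ae_of_all _ fun ω => ?_)).trans (by simp)
    simp only [Set.indicator, Real.norm_eq_abs, abs_abs]
    split_ifs <;> simp

/-- The quantile coupling attains the Wasserstein distance. -/
lemma integral_abs_quantile_sub (ξ₁ ξ₂ : Distr β) :
    ∫ v, |quantile ξ₁ v - quantile ξ₂ v| = dW ξ₁ ξ₂ := by
  rw [integral_abs_sub_eq ξ₁.nonneg volume (measurable_quantile ξ₁) (measurable_quantile ξ₂)
    (fun v => ⟨quantile_nonneg _ v, quantile_le _ v⟩)
    fun v => ⟨quantile_nonneg _ v, quantile_le _ v⟩]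
  refine intervalIntegral.integral_congr fun t ht => ?_
  rw [Set.uIcc_of_le ξ₁.nonneg] at ht
  rw [integral_abs_indicator_sub _ (measurableSet_le (measurable_quantile ξ₁) measurable_const)
    (measurableSet_le (measurable_quantile ξ₂) measurable_const),
    volume_real_quantile_le, volume_real_quantile_le]
  simp only [quantile_le_iff _ _ ht.1]
  rcases le_total (distrFun ξ₁ t) (distrFun ξ₂ t) with h | h
  · exact Or.inl fun v hv => le_trans hv h
  · exact Or.inr fun v hv => le_trans hv h

lemma dW_nonneg (ξ₁ ξ₂ : Distr β) : 0 ≤ dW ξ₁ ξ₂ :=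
  intervalIntegral.integral_nonneg ξ₁.nonneg fun _ _ => abs_nonneg _

lemma dW_self (ξ : Distr β) : dW ξ ξ = 0 := by simp [dW]

end Wasserstein

/-! ### Independence of the inputs and integration against the next one -/

section Input

variable {Ω : Type u} [mΩ : MeasurableSpace Ω] {P : Measure Ω} {U V W : ℕ → Ω → Set.Icc (0 : ℝ) 1}

/-- The random input of one step of the urn. -/
def input (U V W : ℕ → Ω → Set.Icc (0 : ℝ) 1) (n : ℕ) (ω : Ω) :
    Set.Icc (0 : ℝ) 1 × Set.Icc (0 : ℝ) 1 × Set.Icc (0 : ℝ) 1 :=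
  (U n ω, V n ω, W n ω)

lemma IsUrnInput.measurable_input (h : IsUrnInput P U V W) (n : ℕ) : Measurable (input U V W n) :=
  (h.measurable_U n).prodMk ((h.measurable_V n).prodMk (h.measurable_W n))

lemma IsUrnInput.iIndepFun_input [IsProbabilityMeasure P] (h : IsUrnInput P U V W) :
    iIndepFun (input U V W) P := by
  -- Preimages of measurable rectangles form a generating π-system, and on rectangles independence
  -- factors through the two given sequences.
  refine iIndepSets.iIndep (fun n => (h.measurable_input n).comap_le)
    (fun n => Set.preimage (input U V W n) ''
      (Set.image2 (· ×ˢ ·) {s | MeasurableSet s} {t | MeasurableSet t}))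
    (fun n => isPiSystem_prod.comap _) (fun n => ?_) ?_
  · rw [← generateFrom_prod, MeasurableSpace.comap_generateFrom]
  rw [iIndepSets_iff]
  intro S f hf
  choose! t ht htf using hf
  choose! a ha b hb hab using ht
  have hset : ∀ i ∈ S, f i = U i ⁻¹' a i ∩ (fun ω => (V i ω, W i ω)) ⁻¹' b i := fun i hi => by
    rw [← htf i hi, ← hab i hi]; rfl
  have hU := (iIndepFun_iff_measure_inter_preimage_eq_mul.1 h.iIndepFun_U) S ha
  have hVW := (iIndepFun_iff_measure_inter_preimage_eq_mul.1 h.iIndepFun_VW) S hb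
  have hind := h.indepFun_U_VW.measure_inter_preimage_eq_mul
  have e1 : ⋂ i ∈ S, f i = (fun ω n => U n ω) ⁻¹' (⋂ i ∈ S, (fun x => x i) ⁻¹' a i) ∩
      (fun ω n => (V n ω, W n ω)) ⁻¹' (⋂ i ∈ S, (fun x => x i) ⁻¹' b i) := by
    ext ω
    simp only [Set.mem_iInter, Set.mem_inter_iff, Set.mem_preimage]
    refine ⟨fun H => ⟨fun i hi => ?_, fun i hi => ?_⟩, fun H i hi => ?_⟩
    · have := H i hi; rw [hset i hi] at this; exact this.1
    · have := H i hi; rw [hset i hi] at this; exact this.2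
    · rw [hset i hi]; exact ⟨H.1 i hi, H.2 i hi⟩
  have e2 : (fun ω n => U n ω) ⁻¹' (⋂ i ∈ S, (fun x => x i) ⁻¹' a i) = ⋂ i ∈ S, U i ⁻¹' a i := by
    simp only [Set.preimage_iInter]; rfl
  have e3 : (fun ω n => (V n ω, W n ω)) ⁻¹' (⋂ i ∈ S, (fun x => x i) ⁻¹' b i) =
      ⋂ i ∈ S, (fun ω => (V i ω, W i ω)) ⁻¹' b i := by
    simp only [Set.preimage_iInter]; rfl
  rw [e1, hind _ _ (S.measurableSet_biInter fun i hi => measurable_pi_apply i (ha i hi))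
    (S.measurableSet_biInter fun i hi => measurable_pi_apply i (hb i hi)), e2, e3, hU, hVW,
    ← Finset.prod_mul_distrib]
  have hUVi : ∀ i, IndepFun (U i) (fun ω => (V i ω, W i ω)) P := fun i =>
    h.indepFun_U_VW.comp (measurable_pi_apply i) (measurable_pi_apply i)
  refine Finset.prod_congr rfl fun i hi => ?_
  rw [hset i hi, (hUVi i).measure_inter_preimage_eq_mul _ _ (ha i hi) (hb i hi)]

/-- The past of the input: at time `n` the first `n` inputs are known. -/
def IsUrnInput.history (h : IsUrnInput P U V W) : Filtration ℕ mΩ where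
  seq n := ⨆ k ∈ Set.Iio n, MeasurableSpace.comap (input U V W k) inferInstance
  mono' _ _ hmn := biSup_mono fun _ hk => lt_of_lt_of_le hk hmn
  le' _ := iSup₂_le fun k _ => (h.measurable_input k).comap_le

lemma IsUrnInput.measurable_input_history (h : IsUrnInput P U V W) (n : ℕ) :
    Measurable[h.history (n + 1)] (input U V W n) :=
  (comap_measurable (input U V W n)).mono
    (le_iSup₂ (f := fun k (_ : k ∈ Set.Iio (n + 1)) =>
      MeasurableSpace.comap (input U V W k) inferInstance) n (Nat.lt_succ_self n)) le_rfl

lemma IsUrnInput.indepFun_input [IsProbabilityMeasure P] (h : IsUrnInput P U V W) {n : ℕ}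
    {E : Type*} [MeasurableSpace E] {X : Ω → E} (hX : Measurable[h.history n] X) :
    IndepFun X (input U V W n) P := by
  have h1 := indep_iSup_of_disjoint (fun k => (h.measurable_input k).comap_le) h.iIndepFun_input
    (S := Set.Iio n) (T := {n}) (by simp)
  rw [IndepFun_iff_Indep]
  refine indep_of_indep_of_le_left (indep_of_indep_of_le_right h1 ?_) hX.comap_le
  simp

lemma IsUrnInput.map_input [IsProbabilityMeasure P] (h : IsUrnInput P U V W) (n : ℕ) :
    P.map (input U V W n) = (volume : Measure (Set.Icc (0 : ℝ) 1)).prod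
      (P.map fun ω => (V 0 ω, W 0 ω)) := by
  have hUVn : IndepFun (U n) (fun ω => (V n ω, W n ω)) P :=
    h.indepFun_U_VW.comp (measurable_pi_apply n) (measurable_pi_apply n)
  have := (indepFun_iff_map_prod_eq_prod_map_map (h.measurable_U n).aemeasurable
    ((h.measurable_V n).prodMk (h.measurable_W n)).aemeasurable).1 hUVn
  rw [h.map_U, (h.identDistrib_VW n).map_eq] at this
  exact this

/-- The expectation of a function of the past and of the next input. -/
lemma IsUrnInput.integral_comp_input [IsProbabilityMeasure P] (h : IsUrnInput P U V W) {n : ℕ}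
    {E : Type*} [MeasurableSpace E] {X : Ω → E} (hX : Measurable[h.history n] X)
    {φ : E → Set.Icc (0 : ℝ) 1 × Set.Icc (0 : ℝ) 1 × Set.Icc (0 : ℝ) 1 → ℝ}
    (hφ : Measurable (Function.uncurry φ))
    (hint : Integrable (fun ω => φ (X ω) (input U V W n ω)) P) :
    ∫ ω, φ (X ω) (input U V W n ω) ∂P = ∫ ω, ∫ r, φ (X ω) r ∂(P.map (input U V W n)) ∂P := by
  have hX' : Measurable X := hX.mono (h.history.le n) le_rfl
  have hi := h.measurable_input n
  have := Measure.isProbabilityMeasure_map (μ := P) hi.aemeasurable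
  have := Measure.isProbabilityMeasure_map (μ := P) hX'.aemeasurable
  have hmap := (indepFun_iff_map_prod_eq_prod_map_map hX'.aemeasurable hi.aemeasurable).1
    (h.indepFun_input hX)
  have hint' : Integrable (Function.uncurry φ) ((P.map X).prod (P.map (input U V W n))) := by
    rw [← hmap]
    exact (integrable_map_measure hφ.aestronglyMeasurable (hX'.prodMk hi).aemeasurable).2 hint
  have h1 := integral_map (μ := P) (hX'.prodMk hi).aemeasurable (f := Function.uncurry φ)
    hφ.aestronglyMeasurable
  rw [hmap, integral_prod _ hint'] at h1
  exact h1.symm.trans (integral_map hX'.aemeasurable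
    hφ.stronglyMeasurable.integral_prod_right'.aestronglyMeasurable)

/-- The colour is chosen independently of the reinforcements, and each branch sees only one of `V`,
`W`. The unknown joint law of `(V, W)` therefore enters only through its uniform marginals. -/
lemma IsUrnInput.integral_input_ite [IsProbabilityMeasure P] (h : IsUrnInput P U V W) (n : ℕ)
    {z : ℝ} (hz : z ∈ Set.Icc (0 : ℝ) 1) {f g : Set.Icc (0 : ℝ) 1 → ℝ} (hf : Measurable f)
    (hg : Measurable g) {C : ℝ} (hfC : ∀ v, |f v| ≤ C) (hgC : ∀ v, |g v| ≤ C) :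
    ∫ r, (if (r.1 : ℝ) ≤ z then f r.2.1 else g r.2.2) ∂(P.map (input U V W n)) =
      z * (∫ v, f v) + (1 - z) * ∫ v, g v := by
  have hVW : Measurable fun ω => (V 0 ω, W 0 ω) := (h.measurable_V 0).prodMk (h.measurable_W 0)
  have := Measure.isProbabilityMeasure_map (μ := P) hVW.aemeasurable
  rw [h.map_input]
  set m := P.map fun ω => (V 0 ω, W 0 ω) with hm
  have hfst : ∫ p, f p.1 ∂m = ∫ v, f v := by
    rw [← h.map_V 0, hm, integral_map (f := fun p => f p.1) hVW.aemeasurable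
      (hf.comp measurable_fst).aestronglyMeasurable, integral_map (h.measurable_V 0).aemeasurable hf.aestronglyMeasurable]
  have hsnd : ∫ p, g p.2 ∂m = ∫ v, g v := by
    rw [← h.map_W 0, hm, integral_map (f := fun p => g p.2) hVW.aemeasurable
      (hg.comp measurable_snd).aestronglyMeasurable, integral_map (h.measurable_W 0).aemeasurable hg.aestronglyMeasurable]
  set s : Set (Set.Icc (0 : ℝ) 1) := {v | (v : ℝ) ≤ z}
  have hs : MeasurableSet s := measurableSet_le measurable_subtype_coe measurable_const
  have hsz : (volume : Measure (Set.Icc (0 : ℝ) 1)).real s = z := volume_real_coe_le hz.1 hz.2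
  have e : ∀ r : Set.Icc (0 : ℝ) 1 × Set.Icc (0 : ℝ) 1 × Set.Icc (0 : ℝ) 1,
      (if (r.1 : ℝ) ≤ z then f r.2.1 else g r.2.2) =
      s.indicator 1 r.1 * f r.2.1 + sᶜ.indicator 1 r.1 * g r.2.2 := fun r => by
    by_cases hr : (r.1 : ℝ) ≤ z
    · have : r.1 ∈ s := hr
      simp [hr, this]
    · have : r.1 ∉ s := hr
      simp [hr, this]
  have i1 : Integrable (s.indicator (1 : Set.Icc (0 : ℝ) 1 → ℝ)) volume := (integrable_const 1).indicator hs
  have i2 : Integrable (sᶜ.indicator (1 : Set.Icc (0 : ℝ) 1 → ℝ)) volume := (integrable_const 1).indicator hs.compl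
  have j1 : Integrable (fun p : Set.Icc (0 : ℝ) 1 × Set.Icc (0 : ℝ) 1 => f p.1) m :=
    Integrable.of_bound (hf.comp measurable_fst).aestronglyMeasurable C
      (ae_of_all _ fun p => hfC p.1)
  have j2 : Integrable (fun p : Set.Icc (0 : ℝ) 1 × Set.Icc (0 : ℝ) 1 => g p.2) m :=
    Integrable.of_bound (hg.comp measurable_snd).aestronglyMeasurable C
      (ae_of_all _ fun p => hgC p.2)
  simp_rw [e]
  rw [integral_add (i1.mul_prod j1) (i2.mul_prod j2),
    integral_prod_mul (s.indicator (1 : Set.Icc (0 : ℝ) 1 → ℝ)) 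
      (fun p : Set.Icc (0 : ℝ) 1 × Set.Icc (0 : ℝ) 1 => f p.1),
    integral_prod_mul (sᶜ.indicator (1 : Set.Icc (0 : ℝ) 1 → ℝ)) 
      (fun p : Set.Icc (0 : ℝ) 1 × Set.Icc (0 : ℝ) 1 => g p.2),
    hfst, hsnd, integral_indicator_one hs, integral_indicator_one hs.compl, hsz,
    probReal_compl_eq_one_sub hs, hsz]

end Input

/-! ### Deterministic estimates for one step -/

section Step

variable {β : ℝ}

/-- The total content of the urn. -/
def total (c : ℝ × ℝ) : ℝ := c.1 + c.2

/-- The proportion of the first colour. -/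
noncomputable def ratio (c : ℝ × ℝ) : ℝ := c.1 / (c.1 + c.2)

/-- One step of the urn. -/
noncomputable def step (μ ν : Distr β) (c : ℝ × ℝ)
    (r : Set.Icc (0 : ℝ) 1 × Set.Icc (0 : ℝ) 1 × Set.Icc (0 : ℝ) 1) : ℝ × ℝ :=
  if (r.1 : ℝ) ≤ ratio c then (c.1 + quantile μ r.2.1, c.2) else (c.1, c.2 + quantile ν r.2.2)

lemma total_pos {c : ℝ × ℝ} (hc : c ∈ Quadrant) : 0 < total c := by
  obtain ⟨⟨h1, h2⟩, h3⟩ := hc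
  simp only [Set.mem_Ici] at h1 h2
  rcases (add_nonneg h1 h2).lt_or_eq with h | h
  · exact h
  · exact absurd (Prod.ext (by simp; linarith) (by simp; linarith)) h3

lemma mem_quadrant {c : ℝ × ℝ} (h1 : 0 ≤ c.1) (h2 : 0 ≤ c.2) (h : 0 < total c) : c ∈ Quadrant :=
  ⟨⟨h1, h2⟩, fun h0 => by rw [Set.mem_singleton_iff.1 h0] at h; simp [total] at h⟩

lemma ratio_mem {c : ℝ × ℝ} (hc : c ∈ Quadrant) : ratio c ∈ Set.Icc (0 : ℝ) 1 := by
  have := total_pos hc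
  obtain ⟨⟨h1, h2⟩, -⟩ := hc
  simp only [Set.mem_Ici] at h1 h2
  exact ⟨div_nonneg h1 (add_nonneg h1 h2), (div_le_one this).2 (by unfold total; linarith)⟩

lemma total_step (μ ν : Distr β) (c : ℝ × ℝ)
    (r : Set.Icc (0 : ℝ) 1 × Set.Icc (0 : ℝ) 1 × Set.Icc (0 : ℝ) 1) :
    total (step μ ν c r) =
      total c + if (r.1 : ℝ) ≤ ratio c then quantile μ r.2.1 else quantile ν r.2.2 := by
  unfold step
  split_ifs <;> simp only [total] <;> ring

lemma total_le_total_step (μ ν : Distr β) (c : ℝ × ℝ)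
    (r : Set.Icc (0 : ℝ) 1 × Set.Icc (0 : ℝ) 1 × Set.Icc (0 : ℝ) 1) :
    total c ≤ total (step μ ν c r) := by
  rw [total_step]
  split_ifs <;> simp [quantile_nonneg]

lemma step_mem (μ ν : Distr β) {c : ℝ × ℝ} (hc : c ∈ Quadrant)
    (r : Set.Icc (0 : ℝ) 1 × Set.Icc (0 : ℝ) 1 × Set.Icc (0 : ℝ) 1) :
    step μ ν c r ∈ Quadrant := by
  have h := (total_pos hc).trans_le (total_le_total_step μ ν c r)
  obtain ⟨⟨h1, h2⟩, -⟩ := hc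
  simp only [Set.mem_Ici] at h1 h2
  refine mem_quadrant ?_ ?_ h <;> unfold step <;> split_ifs <;>
    simp [h1, h2, add_nonneg, quantile_nonneg]

lemma measurable_ratio : Measurable ratio :=
  measurable_fst.div (measurable_fst.add measurable_snd)

lemma measurable_total : Measurable total := measurable_fst.add measurable_snd

lemma measurable_step (μ ν : Distr β) : Measurable (Function.uncurry (step μ ν)) := by
  have h1 := measurable_quantile μ
  have h2 := measurable_quantile ν
  have h3 := measurable_ratio
  refine Measurable.ite (measurableSet_le (by fun_prop) (by fun_prop)) (by fun_prop) (by fun_prop)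

lemma ratio_add_fst_sub {c : ℝ × ℝ} (hc : c ∈ Quadrant) {R : ℝ} (hR : 0 ≤ R) :
    ratio (c.1 + R, c.2) - ratio c = (1 - ratio c) * (R / (total c + R)) := by
  have h := total_pos hc
  have h' : c.1 + R + c.2 ≠ 0 := by unfold total at h; linarith
  unfold total at *
  unfold ratio
  field_simp
  ring

lemma ratio_add_snd_sub {c : ℝ × ℝ} (hc : c ∈ Quadrant) {R : ℝ} (hR : 0 ≤ R) :
    ratio (c.1, c.2 + R) - ratio c = -ratio c * (R / (total c + R)) := by
  have h := total_pos hc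
  have h' : c.1 + (c.2 + R) ≠ 0 := by unfold total at h; linarith
  unfold total at *
  unfold ratio
  field_simp
  ring

/-- Put `q = R² / (T (T + R))`. Linearizing the increment costs at most `2 q`, since `|a ζ| ≤ 2`,
and the squared increment is at most `q`. The decrease of `3β / T` is `3β R / (T (T + R)) ≥ 3 q`,
which explains the constant `3β`. -/
lemma gain_bound {T R a ζ : ℝ} (hT : 0 < T) (hR : 0 ≤ R) (hRβ : R ≤ β) (ha : |a| ≤ 2)
    (hζ : |ζ| ≤ 1) :
    a * (ζ * (R / (T + R))) + (ζ * (R / (T + R))) ^ 2 + 3 * β * (1 / (T + R) - 1 / T) ≤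
      a * ζ / T * R := by
  have h1 : a * (ζ * (R / (T + R))) - a * ζ / T * R = -(a * ζ) * (R ^ 2 / (T * (T + R))) := by
    field_simp
    ring
  have h2 : 3 * β * (1 / (T + R) - 1 / T) = -(3 * β * R / (T * (T + R))) := by
    field_simp
    ring
  have h3 : -(a * ζ) ≤ 2 := by
    have : |a * ζ| ≤ 2 * 1 := by rw [abs_mul]; gcongr
    linarith [neg_abs_le (a * ζ)]
  have h4 : (ζ * (R / (T + R))) ^ 2 ≤ R ^ 2 / (T * (T + R)) := by
    have : (ζ * (R / (T + R))) ^ 2 = ζ ^ 2 * (R ^ 2 / ((T + R) * (T + R))) := by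
      field_simp
    rw [this]
    have hζ2 : ζ ^ 2 ≤ 1 := (sq_le_one_iff_abs_le_one ζ).2 hζ
    calc ζ ^ 2 * (R ^ 2 / ((T + R) * (T + R))) ≤ 1 * (R ^ 2 / (T * (T + R))) := by
          gcongr
          linarith
      _ = _ := one_mul _
  have h5 : 0 ≤ R ^ 2 / (T * (T + R)) := by positivity
  have h6 : 3 * (R ^ 2 / (T * (T + R))) ≤ 3 * β * R / (T * (T + R)) := by
    rw [← mul_div_assoc]
    refine div_le_div_of_nonneg_right ?_ (by positivity)
    nlinarith
  have h7 : -(a * ζ) * (R ^ 2 / (T * (T + R))) ≤ 2 * (R ^ 2 / (T * (T + R))) := by gcongr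
  linarith

/-- The right side is linear in the reinforcement, so its conditional expectation involves only the
means; for equal means the two colours cancel. -/
lemma lyapunov_step_le (μ ν : Distr β) {c : ℝ × ℝ} (hc : c ∈ Quadrant)
    (r : Set.Icc (0 : ℝ) 1 × Set.Icc (0 : ℝ) 1 × Set.Icc (0 : ℝ) 1) {a : ℝ} (ha : |a| ≤ 2) :
    a * (ratio (step μ ν c r) - ratio c) + (ratio (step μ ν c r) - ratio c) ^ 2 +
        3 * β * (1 / total (step μ ν c r) - 1 / total c) ≤
      if (r.1 : ℝ) ≤ ratio c then a * (1 - ratio c) / total c * quantile μ r.2.1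
      else a * (-ratio c) / total c * quantile ν r.2.2 := by
  have hz := ratio_mem hc
  rw [total_step]
  unfold step
  split_ifs
  · rw [ratio_add_fst_sub hc (quantile_nonneg _ _)]
    exact gain_bound (total_pos hc) (quantile_nonneg _ _) (quantile_le _ _) ha
      (abs_le.2 ⟨by linarith [hz.2], by linarith [hz.1]⟩)
  · rw [ratio_add_snd_sub hc (quantile_nonneg _ _)]
    exact gain_bound (total_pos hc) (quantile_nonneg _ _) (quantile_le _ _) ha
      (abs_le.2 ⟨by linarith [hz.2], by linarith [hz.1]⟩)

/-- Replacing `R` by `β` in the denominator again leaves a bound linear in the reinforcement, so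
that only the mean matters after conditioning. -/
lemma inv_total_step_sub_le (μ ν : Distr β) {c : ℝ × ℝ} (hc : c ∈ Quadrant)
    (r : Set.Icc (0 : ℝ) 1 × Set.Icc (0 : ℝ) 1 × Set.Icc (0 : ℝ) 1) :
    1 / total (step μ ν c r) - 1 / total c ≤
      if (r.1 : ℝ) ≤ ratio c then -(1 / (total c * (total c + β))) * quantile μ r.2.1
      else -(1 / (total c * (total c + β))) * quantile ν r.2.2 := by
  have hT := total_pos hc
  have key : ∀ R, 0 ≤ R → R ≤ β →
      1 / (total c + R) - 1 / total c ≤ -(1 / (total c * (total c + β))) * R := by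
    intro R h0 h1
    have h2 : 1 / (total c + R) - 1 / total c = -(R / (total c * (total c + R))) := by
      field_simp
      ring
    rw [h2, neg_mul, neg_le_neg_iff, one_div_mul_eq_div]
    gcongr
  rw [total_step]
  split_ifs <;> exact key _ (quantile_nonneg _ _) (quantile_le _ _)

end Step

/-! ### The urn as an adapted process -/

section Urn

variable {β : ℝ} {Ω : Type u} {U V W : ℕ → Ω → Set.Icc (0 : ℝ) 1}

lemma urn_succ (μ ν : Distr β) (s : ℝ × ℝ) (n : ℕ) (ω : Ω) :
    urn μ ν U V W s (n + 1) ω = step μ ν (urn μ ν U V W s n ω) (input U V W n ω) := rfl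

lemma urn_mem (μ ν : Distr β) {s : ℝ × ℝ} (hs : s ∈ Quadrant) (n : ℕ) (ω : Ω) :
    urn μ ν U V W s n ω ∈ Quadrant := by
  induction n with
  | zero => exact hs
  | succ n ih => rw [urn_succ]; exact step_mem μ ν ih _

lemma total_urn_mono (μ ν : Distr β) (s : ℝ × ℝ) (ω : Ω) :
    Monotone fun n => total (urn μ ν U V W s n ω) :=
  monotone_nat_of_le_succ fun n => by
    rw [urn_succ]; exact total_le_total_step μ ν _ _

lemma total_le_total_urn (μ ν : Distr β) (s : ℝ × ℝ) (n : ℕ) (ω : Ω) :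
    total s ≤ total (urn μ ν U V W s n ω) :=
  total_urn_mono μ ν s ω (Nat.zero_le n)

variable [mΩ : MeasurableSpace Ω] {P : Measure Ω}

lemma IsUrnInput.measurable_urn_history (h : IsUrnInput P U V W) (μ ν : Distr β) (s : ℝ × ℝ)
    (n : ℕ) : Measurable[h.history n] (urn μ ν U V W s n) := by
  induction n with
  | zero => exact measurable_const
  | succ n ih =>
    exact (measurable_step μ ν).comp
      ((ih.mono (h.history.mono n.le_succ) le_rfl).prodMk (h.measurable_input_history n))

lemma IsUrnInput.measurable_urn (h : IsUrnInput P U V W) (μ ν : Distr β) (s : ℝ × ℝ) (n : ℕ) :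
    Measurable (urn μ ν U V W s n) :=
  (h.measurable_urn_history μ ν s n).mono (h.history.le n) le_rfl

lemma IsUrnInput.integral_ite_quantile [IsProbabilityMeasure P] (h : IsUrnInput P U V W)
    (μ ν : Distr β) {n : ℕ} {α γ ζ : Ω → ℝ} (hα : Measurable[h.history n] α)
    (hγ : Measurable[h.history n] γ) (hζ : Measurable[h.history n] ζ) {K : ℝ}
    (hαK : ∀ ω, |α ω| ≤ K) (hγK : ∀ ω, |γ ω| ≤ K) (hζ' : ∀ ω, ζ ω ∈ Set.Icc (0 : ℝ) 1) :
    Integrable (fun ω => if (U n ω : ℝ) ≤ ζ ω then α ω * quantile μ (V n ω)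
        else γ ω * quantile ν (W n ω)) P ∧
    ∫ ω, (if (U n ω : ℝ) ≤ ζ ω then α ω * quantile μ (V n ω)
        else γ ω * quantile ν (W n ω)) ∂P =
      ∫ ω, ζ ω * (α ω * mean μ) + (1 - ζ ω) * (γ ω * mean ν) ∂P := by
  have hX : Measurable[h.history n] fun ω => (α ω, γ ω, ζ ω) := hα.prodMk (hγ.prodMk hζ)
  let φ : ℝ × ℝ × ℝ → Set.Icc (0 : ℝ) 1 × Set.Icc (0 : ℝ) 1 × Set.Icc (0 : ℝ) 1 → ℝ :=
    fun x r => if (r.1 : ℝ) ≤ x.2.2 then x.1 * quantile μ r.2.1 else x.2.1 * quantile ν r.2.2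
  have hφ : Measurable (Function.uncurry φ) := by
    have h1 := measurable_quantile μ
    have h2 := measurable_quantile ν
    exact Measurable.ite (measurableSet_le (by fun_prop) (by fun_prop)) (by fun_prop) (by fun_prop)
  have hb : ∀ (ξ : Distr β) (a : ℝ) (v : Set.Icc (0 : ℝ) 1), |a| ≤ K → |a * quantile ξ v| ≤ K * β :=
    fun ξ a v ha => by
    rw [abs_mul, abs_of_nonneg (quantile_nonneg _ _)]
    exact mul_le_mul ha (quantile_le _ _) (quantile_nonneg _ _) ((abs_nonneg a).trans ha)
  have hint : Integrable (fun ω => φ (α ω, γ ω, ζ ω) (input U V W n ω)) P := by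
    refine Integrable.of_bound (C := K * β) (hφ.comp
      ((hX.mono (h.history.le n) le_rfl).prodMk (h.measurable_input n))).aestronglyMeasurable
      (ae_of_all _ fun ω => ?_)
    simp only [φ, Real.norm_eq_abs]
    split_ifs
    · exact hb _ _ _ (hαK ω)
    · exact hb _ _ _ (hγK ω)
  refine ⟨hint, (h.integral_comp_input hX hφ hint).trans (integral_congr_ae
    (ae_of_all _ fun ω => ?_))⟩
  refine (h.integral_input_ite n (hζ' ω) ((measurable_quantile μ).const_mul (α ω))
    ((measurable_quantile ν).const_mul (γ ω)) (fun v => hb μ _ v (hαK ω))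
    fun v => hb ν _ v (hγK ω)).trans ?_
  rw [integral_const_mul, integral_const_mul, integral_quantile, integral_quantile]

end Urn

/-! ### Almost sure convergence and uniform `L¹` estimates -/

section Convergence

variable {β : ℝ} {Ω : Type u} {U V W : ℕ → Ω → Set.Icc (0 : ℝ) 1} {μ ν : Distr β} {s : ℝ × ℝ}

lemma inv_total_urn_nonneg (hs : s ∈ Quadrant) (n : ℕ) (ω : Ω) :
    0 ≤ 1 / total (urn μ ν U V W s n ω) :=
  one_div_nonneg.2 (total_pos (urn_mem μ ν hs n ω)).le

lemma inv_total_urn_le (hs : s ∈ Quadrant) (n : ℕ) (ω : Ω) :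
    1 / total (urn μ ν U V W s n ω) ≤ 1 / total s :=
  one_div_le_one_div_of_le (total_pos hs) (total_le_total_urn μ ν s n ω)

lemma abs_ratio_sub_le {c d : ℝ × ℝ} (hc : c ∈ Quadrant) (hd : d ∈ Quadrant) :
    |ratio c - ratio d| ≤ 1 := by
  have h1 := ratio_mem hc
  have h2 := ratio_mem hd
  rw [abs_le]
  constructor <;> linarith [h1.1, h1.2, h2.1, h2.2]

variable [mΩ : MeasurableSpace Ω] {P : Measure Ω} [IsProbabilityMeasure P]

lemma IsUrnInput.integrable_ratio (h : IsUrnInput P U V W) (hs : s ∈ Quadrant) (n : ℕ) :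
    Integrable (fun ω => ratio (urn μ ν U V W s n ω)) P :=
  Integrable.of_bound (measurable_ratio.comp (h.measurable_urn μ ν s n)).aestronglyMeasurable 1
    (ae_of_all _ fun ω => by
      have := ratio_mem (urn_mem (U := U) (V := V) (W := W) μ ν hs n ω)
      rw [Real.norm_eq_abs, abs_of_nonneg this.1]
      exact this.2)

lemma IsUrnInput.integrable_inv_total (h : IsUrnInput P U V W) (hs : s ∈ Quadrant) (n : ℕ) :
    Integrable (fun ω => 1 / total (urn μ ν U V W s n ω)) P :=
  Integrable.of_bound ((measurable_total.comp
    (h.measurable_urn μ ν s n)).const_div 1).aestronglyMeasurable (1 / total s)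
    (ae_of_all _ fun ω => by
      rw [Real.norm_eq_abs, abs_of_nonneg (inv_total_urn_nonneg hs n ω)]
      exact inv_total_urn_le hs n ω)

lemma IsUrnInput.integrable_ratio_sub_sq (h : IsUrnInput P U V W) (hs : s ∈ Quadrant) (m n : ℕ) :
    Integrable (fun ω => (ratio (urn μ ν U V W s m ω) - ratio (urn μ ν U V W s n ω)) ^ 2) P :=
  Integrable.of_bound (((measurable_ratio.comp (h.measurable_urn μ ν s m)).sub
    (measurable_ratio.comp (h.measurable_urn μ ν s n))).pow_const 2).aestronglyMeasurable 1
    (ae_of_all _ fun ω => by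
      rw [Real.norm_eq_abs, abs_of_nonneg (sq_nonneg _)]
      exact (sq_le_one_iff_abs_le_one _).2
        (abs_ratio_sub_le (urn_mem μ ν hs m ω) (urn_mem μ ν hs n ω)))

/-- For equal means, `1 / (Xₙ + Yₙ)` compensates the drift and the variance of the proportion. -/
lemma IsUrnInput.integral_lyapunov_nonpos (h : IsUrnInput P U V W) (hmean : mean μ = mean ν)
    (hs : s ∈ Quadrant) {n : ℕ} {A B : Ω → ℝ} (hA : Measurable[h.history n] A)
    (hB : Measurable[h.history n] B) (hA2 : ∀ ω, |A ω| ≤ 2) (hB0 : ∀ ω, 0 ≤ B ω)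
    (hB1 : ∀ ω, B ω ≤ 1) :
    ∫ ω, B ω * (A ω * (ratio (urn μ ν U V W s (n + 1) ω) - ratio (urn μ ν U V W s n ω)) +
      (ratio (urn μ ν U V W s (n + 1) ω) - ratio (urn μ ν U V W s n ω)) ^ 2 +
      3 * β * (1 / total (urn μ ν U V W s (n + 1) ω) - 1 / total (urn μ ν U V W s n ω))) ∂P ≤ 0 := by
  have hZ : Measurable[h.history n] fun ω => ratio (urn μ ν U V W s n ω) :=
    measurable_ratio.comp (h.measurable_urn_history μ ν s n)
  have hT : Measurable[h.history n] fun ω => total (urn μ ν U V W s n ω) :=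
    measurable_total.comp (h.measurable_urn_history μ ν s n)
  have hbound : ∀ ω (x : ℝ), |x| ≤ 1 →
      |B ω * (A ω * x / total (urn μ ν U V W s n ω))| ≤ 2 * (1 / total s) := by
    intro ω x hx
    rw [abs_mul, div_eq_mul_one_div, abs_mul, abs_mul, abs_of_nonneg (hB0 ω),
      abs_of_nonneg (inv_total_urn_nonneg hs n ω)]
    calc B ω * (|A ω| * |x| * (1 / total (urn μ ν U V W s n ω)))
        ≤ 1 * (2 * 1 * (1 / total s)) := by
          have := inv_total_urn_le (μ := μ) (ν := ν) (U := U) (V := V) (W := W) hs n ω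
          have := inv_total_urn_nonneg (μ := μ) (ν := ν) (U := U) (V := V) (W := W) hs n ω
          have := hB0 ω; have := hB1 ω; have := hA2 ω
          gcongr
      _ = _ := by ring
  obtain ⟨hint, heq⟩ := h.integral_ite_quantile (P := P) μ ν
    (hB.mul ((hA.mul (measurable_const.sub hZ)).div hT) : Measurable[h.history n] fun ω =>
      B ω * (A ω * (1 - ratio (urn μ ν U V W s n ω)) / total (urn μ ν U V W s n ω)))
    (hB.mul ((hA.mul hZ.neg).div hT) : Measurable[h.history n] fun ω =>
      B ω * (A ω * (-ratio (urn μ ν U V W s n ω)) / total (urn μ ν U V W s n ω)))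
    hZ (fun ω => hbound ω _ (by
      have := ratio_mem (urn_mem (U := U) (V := V) (W := W) μ ν hs n ω)
      exact abs_le.2 ⟨by linarith [this.2], by linarith [this.1]⟩))
    (fun ω => hbound ω _ (by
      have := ratio_mem (urn_mem (U := U) (V := V) (W := W) μ ν hs n ω)
      exact abs_le.2 ⟨by linarith [this.2], by linarith [this.1]⟩))
    (fun ω => ratio_mem (urn_mem μ ν hs n ω))
  have hzero : ∫ ω, ratio (urn μ ν U V W s n ω) *
      (B ω * (A ω * (1 - ratio (urn μ ν U V W s n ω)) / total (urn μ ν U V W s n ω)) * mean μ) +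
      (1 - ratio (urn μ ν U V W s n ω)) *
      (B ω * (A ω * (-ratio (urn μ ν U V W s n ω)) / total (urn μ ν U V W s n ω)) * mean ν) ∂P
      = 0 := by
    rw [← hmean, ← integral_zero Ω ℝ]
    refine integral_congr_ae (ae_of_all _ fun ω => ?_)
    simp only
    ring
  -- If the integrand were not integrable, its Bochner integral would be zero by convention, and the
  -- claim would hold trivially.
  by_cases hi : Integrable (fun ω => B ω *
      (A ω * (ratio (urn μ ν U V W s (n + 1) ω) - ratio (urn μ ν U V W s n ω)) +
      (ratio (urn μ ν U V W s (n + 1) ω) - ratio (urn μ ν U V W s n ω)) ^ 2 +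
      3 * β * (1 / total (urn μ ν U V W s (n + 1) ω) - 1 / total (urn μ ν U V W s n ω)))) P
  · refine (integral_mono hi hint fun ω => ?_).trans (heq.trans hzero).le
    refine (mul_le_mul_of_nonneg_left (lyapunov_step_le μ ν (urn_mem μ ν hs n ω)
      (input U V W n ω) (hA2 ω)) (hB0 ω)).trans_eq ?_
    change (B ω * if (U n ω : ℝ) ≤ _ then _ * quantile μ (V n ω) else _ * quantile ν (W n ω)) =
      if (U n ω : ℝ) ≤ _ then B ω * _ * quantile μ (V n ω) else B ω * _ * quantile ν (W n ω)
    rw [mul_ite, mul_assoc, mul_assoc]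
  · rw [integral_undef hi]

/-- The proportion alone need not be a martingale, because reinforcements of equal mean can have
different laws. Subtracting `3β / T` absorbs any negative drift. -/
lemma IsUrnInput.submartingale_ratio_sub (h : IsUrnInput P U V W) (hmean : mean μ = mean ν)
    (hs : s ∈ Quadrant) :
    Submartingale (fun n ω => ratio (urn μ ν U V W s n ω) -
      3 * β * (1 / total (urn μ ν U V W s n ω))) h.history P := by
  have hint : ∀ n, Integrable (fun ω => ratio (urn μ ν U V W s n ω) -
      3 * β * (1 / total (urn μ ν U V W s n ω))) P := fun n =>
    (h.integrable_ratio hs n).sub ((h.integrable_inv_total hs n).const_mul _)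
  refine submartingale_of_setIntegral_le_succ (fun n => ?_) hint fun n S hS => ?_
  · have hm : Measurable[h.history n] fun ω => ratio (urn μ ν U V W s n ω) -
        3 * β * (1 / total (urn μ ν U V W s n ω)) :=
      (measurable_ratio.sub ((measurable_total.const_div 1).const_mul (3 * β))).comp
        (h.measurable_urn_history μ ν s n)
    exact hm.stronglyMeasurable
  have hS' := h.history.le n S hS
  rw [← sub_nonpos, ← integral_sub (hint n).integrableOn (hint (n + 1)).integrableOn,
    ← integral_indicator hS']
  -- The weight `B` localizes to the past event `S`, and `A = -1` turns the inequality into a lower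
  -- bound for the drift; the square is then dropped.
  have hL := h.integral_lyapunov_nonpos hmean hs (n := n) (A := fun _ => -1)
    (B := S.indicator fun _ => 1) measurable_const (measurable_const.indicator hS) (fun _ => by norm_num)
    (fun _ => Set.indicator_nonneg (fun _ _ => zero_le_one) _)
    (fun _ => Set.indicator_le_self' (fun _ _ => zero_le_one) _)
  refine le_trans (integral_mono (((hint n).sub (hint (n + 1))).indicator hS') ?_ fun ω => ?_) hL
  · have hR : ∀ k, Integrable (fun ω => ratio (urn μ ν U V W s k ω)) P := h.integrable_ratio hs
    have hT : ∀ k, Integrable (fun ω => 1 / total (urn μ ν U V W s k ω)) P :=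
      h.integrable_inv_total hs
    have hQ : Integrable (fun ω => (ratio (urn μ ν U V W s (n + 1) ω) -
        ratio (urn μ ν U V W s n ω)) ^ 2) P := h.integrable_ratio_sub_sq hs (n + 1) n
    have := (((((hR (n + 1)).sub (hR n)).const_mul (-1)).add hQ).add
      (((hT (n + 1)).sub (hT n)).const_mul (3 * β))).indicator hS'
    refine this.congr (ae_of_all _ fun ω => ?_)
    by_cases hω : ω ∈ S <;> simp [hω]
  · by_cases hω : ω ∈ S
    · simp only [hω, Set.indicator_of_mem, one_mul]
      nlinarith [sq_nonneg (ratio (urn μ ν U V W s (n + 1) ω) - ratio (urn μ ν U V W s n ω))]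
    · simp [hω]

/-- For equal means the proportion converges almost surely. -/
lemma IsUrnInput.exists_limit (h : IsUrnInput P U V W) (hmean : mean μ = mean ν)
    (hs : s ∈ Quadrant) :
    ∃ Zlim : Ω → Set.Icc (0 : ℝ) 1, Measurable Zlim ∧
      ∀ᵐ ω ∂P, Tendsto (fun n => ratio (urn μ ν U V W s n ω)) atTop (𝓝 (Zlim ω : ℝ)) := by
  have hβ := μ.nonneg
  have hbdd : ∀ n, eLpNorm (fun ω => ratio (urn μ ν U V W s n ω) -
      3 * β * (1 / total (urn μ ν U V W s n ω))) 1 P ≤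
      ((1 + 3 * β * (1 / total s)).toNNReal : ENNReal) := by
    intro n
    refine (eLpNorm_le_of_ae_bound (C := 1 + 3 * β * (1 / total s)) (ae_of_all _ fun ω => ?_)).trans
      ?_
    · have h1 := ratio_mem (urn_mem (U := U) (V := V) (W := W) μ ν hs n ω)
      have h2 := inv_total_urn_nonneg (μ := μ) (ν := ν) (U := U) (V := V) (W := W) hs n ω
      have h3 : 3 * β * (1 / total (urn μ ν U V W s n ω)) ≤ 3 * β * (1 / total s) := by
        have := inv_total_urn_le (μ := μ) (ν := ν) (U := U) (V := V) (W := W) hs n ω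
        gcongr
      have h4 : 0 ≤ 3 * β * (1 / total (urn μ ν U V W s n ω)) := by positivity
      rw [Real.norm_eq_abs, abs_le]
      constructor <;> linarith [h1.1, h1.2]
    · simp only [measure_univ, ENNReal.toReal_one, inv_one, ENNReal.one_rpow, one_mul]
      exact le_rfl
  have hconv := (h.submartingale_ratio_sub hmean hs).exists_ae_tendsto_of_bdd hbdd
  let f : ℕ → Ω → Set.Icc (0 : ℝ) 1 := fun n ω =>
    ⟨ratio (urn μ ν U V W s n ω), ratio_mem (urn_mem μ ν hs n ω)⟩
  have hf : ∀ n, AEMeasurable (f n) P := fun n =>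
    ((measurable_ratio.comp (h.measurable_urn μ ν s n)).subtype_mk).aemeasurable
  obtain ⟨Zlim, hm, hZ⟩ := measurable_limit_of_tendsto_metrizable_ae hf (L := atTop) (by
    filter_upwards [hconv] with ω hω
    obtain ⟨c, hc⟩ := hω
    -- The compensator is monotone and bounded below, hence convergent, so it can be added back.
    have hanti : Antitone fun n => 1 / total (urn μ ν U V W s n ω) := fun m n hmn =>
      one_div_le_one_div_of_le (total_pos (urn_mem μ ν hs m ω)) (total_urn_mono μ ν s ω hmn)
    have hT := tendsto_atTop_ciInf hanti ⟨0, by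
      rintro _ ⟨n, rfl⟩; exact inv_total_urn_nonneg hs n ω⟩
    have hZ := hc.add (hT.const_mul (3 * β))
    simp only [sub_add_cancel] at hZ
    have hmem := isClosed_Icc.mem_of_tendsto hZ
      (Eventually.of_forall fun n => ratio_mem (urn_mem (U := U) (V := V) (W := W) μ ν hs n ω))
    exact ⟨⟨_, hmem⟩, tendsto_subtype_rng.2 hZ⟩)
  exact ⟨Zlim, hm, hZ.mono fun ω hω => tendsto_subtype_rng.1 hω⟩

/-- For fixed `n`, the quantity `E (Z_m - Z_n)² + 3β E (1 / T_m)` is nonincreasing in `m ≥ n`, and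
at `m = n` only the second term remains. -/
lemma IsUrnInput.integral_ratio_sub_sq_le (h : IsUrnInput P U V W) (hmean : mean μ = mean ν)
    (hs : s ∈ Quadrant) {m n : ℕ} (hnm : n ≤ m) :
    ∫ ω, (ratio (urn μ ν U V W s m ω) - ratio (urn μ ν U V W s n ω)) ^ 2 ∂P ≤
      3 * β * ∫ ω, 1 / total (urn μ ν U V W s n ω) ∂P := by
  have hβ := μ.nonneg
  have hiT : ∀ k, Integrable (fun ω => 1 / total (urn μ ν U V W s k ω)) P :=
    h.integrable_inv_total hs
  suffices hsuff : ∫ ω, (ratio (urn μ ν U V W s m ω) - ratio (urn μ ν U V W s n ω)) ^ 2 ∂P +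
      3 * β * ∫ ω, 1 / total (urn μ ν U V W s m ω) ∂P ≤
      3 * β * ∫ ω, 1 / total (urn μ ν U V W s n ω) ∂P by
    have : 0 ≤ ∫ ω, 1 / total (urn μ ν U V W s m ω) ∂P :=
      integral_nonneg fun ω => inv_total_urn_nonneg hs m ω
    nlinarith
  induction m, hnm using Nat.le_induction with
  | base => simp
  | succ k hk ih =>
    refine le_trans ?_ ih
    -- This `A` is the coefficient of the cross term when `(Z_{k+1} - Z_n)²` is expanded around
    -- `Z_k`; it is known at time `k` and bounded by `2`.
    have hL := h.integral_lyapunov_nonpos hmean hs (n := k) (μ := μ) (ν := ν) (B := fun _ => 1)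
      (A := fun ω => 2 * (ratio (urn μ ν U V W s k ω) - ratio (urn μ ν U V W s n ω)))
      (((measurable_ratio.comp (h.measurable_urn_history μ ν s k)).sub
        (measurable_ratio.comp ((h.measurable_urn_history μ ν s n).mono (h.history.mono hk)
          le_rfl))).const_mul 2 : Measurable[h.history k] _) measurable_const
      (fun ω => by
        rw [abs_mul, abs_two]
        linarith [abs_ratio_sub_le (urn_mem (U := U) (V := V) (W := W) μ ν hs k ω)
          (urn_mem (U := U) (V := V) (W := W) μ ν hs n ω)]) (fun _ => zero_le_one) fun _ => le_rfl
    have e : ∀ ω, (1 : ℝ) *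
        (2 * (ratio (urn μ ν U V W s k ω) - ratio (urn μ ν U V W s n ω)) *
        (ratio (urn μ ν U V W s (k + 1) ω) - ratio (urn μ ν U V W s k ω)) +
        (ratio (urn μ ν U V W s (k + 1) ω) - ratio (urn μ ν U V W s k ω)) ^ 2 +
        3 * β * (1 / total (urn μ ν U V W s (k + 1) ω) - 1 / total (urn μ ν U V W s k ω))) =
        ((ratio (urn μ ν U V W s (k + 1) ω) - ratio (urn μ ν U V W s n ω)) ^ 2 +
          3 * β * (1 / total (urn μ ν U V W s (k + 1) ω))) -
        ((ratio (urn μ ν U V W s k ω) - ratio (urn μ ν U V W s n ω)) ^ 2 +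
          3 * β * (1 / total (urn μ ν U V W s k ω))) := fun ω => by ring
    have hi : ∀ j, Integrable (fun ω => (ratio (urn μ ν U V W s j ω) -
        ratio (urn μ ν U V W s n ω)) ^ 2) P := fun j => h.integrable_ratio_sub_sq hs j n
    have hg : ∀ j, Integrable (fun ω => (ratio (urn μ ν U V W s j ω) -
        ratio (urn μ ν U V W s n ω)) ^ 2 + 3 * β * (1 / total (urn μ ν U V W s j ω))) P :=
      fun j => (hi j).add ((hiT j).const_mul _)
    simp_rw [e] at hL
    rw [integral_sub (hg _) (hg _),
      integral_add (hi _) ((hiT _).const_mul _), integral_add (hi _) ((hiT _).const_mul _),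
      integral_const_mul, integral_const_mul] at hL
    linarith

/-- The conditional decrease of `1 / T` is at least `m₀ / (T (T + β))`, which is comparable to `1 /
T²` because `T ≥ t`; Jensen's inequality then gives the square of the expectation. -/
lemma IsUrnInput.integral_inv_total_succ_le (h : IsUrnInput P U V W) (hmean : mean μ = mean ν)
    (hs : s ∈ Quadrant) {m₀ t : ℝ} (hm₀ : 0 ≤ m₀) (hm : m₀ ≤ mean μ) (ht : 0 < t)
    (hts : t ≤ total s) (n : ℕ) :
    ∫ ω, 1 / total (urn μ ν U V W s (n + 1) ω) ∂P ≤ ∫ ω, 1 / total (urn μ ν U V W s n ω) ∂P -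
      m₀ * (t / (t + β)) * (∫ ω, 1 / total (urn μ ν U V W s n ω) ∂P) ^ 2 := by
  have hβ := μ.nonneg
  have hiT : ∀ k, Integrable (fun ω => 1 / total (urn μ ν U V W s k ω)) P :=
    h.integrable_inv_total hs
  have hTm : Measurable[h.history n] fun ω => total (urn μ ν U V W s n ω) :=
    measurable_total.comp (h.measurable_urn_history μ ν s n)
  have hTt : ∀ ω, t ≤ total (urn μ ν U V W s n ω) := fun ω =>
    hts.trans (total_le_total_urn μ ν s n ω)
  have hwm : Measurable[h.history n] fun ω =>
      -(1 / (total (urn μ ν U V W s n ω) * (total (urn μ ν U V W s n ω) + β))) :=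
    ((hTm.mul (hTm.add_const β)).const_div 1).neg
  have hwb : ∀ ω, |-(1 / (total (urn μ ν U V W s n ω) * (total (urn μ ν U V W s n ω) + β)))| ≤
      1 / (t * t) := fun ω => by
    have := hTt ω
    have hT : 0 < total (urn μ ν U V W s n ω) := ht.trans_le this
    rw [abs_neg, abs_of_nonneg (by positivity)]
    gcongr
    linarith
  obtain ⟨hint, heq⟩ := h.integral_ite_quantile (P := P) μ ν hwm hwm
    (measurable_ratio.comp (h.measurable_urn_history μ ν s n)) hwb hwb
    (fun ω => ratio_mem (urn_mem μ ν hs n ω))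
  have h1 : ∫ ω, (1 / total (urn μ ν U V W s (n + 1) ω) - 1 / total (urn μ ν U V W s n ω)) ∂P ≤
      _ := (integral_mono ((hiT (n + 1)).sub (hiT n)) hint fun ω =>
        inv_total_step_sub_le μ ν (urn_mem μ ν hs n ω) (input U V W n ω)).trans heq.le
  rw [integral_sub (hiT _) (hiT _)] at h1
  set a := ∫ ω, 1 / total (urn μ ν U V W s n ω) ∂P with ha
  have h2 : ∫ ω, (-(m₀ * (t / (t + β))) * (2 * a * (1 / total (urn μ ν U V W s n ω)) - a ^ 2)) ∂P =
      -(m₀ * (t / (t + β))) * a ^ 2 := by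
    rw [integral_const_mul, integral_sub ((hiT n).const_mul _) (integrable_const _),
      integral_const_mul, ← ha]
    simp only [integral_const, probReal_univ, smul_eq_mul, one_mul]
    ring
  have hwm' : Measurable fun ω =>
      -(1 / (total (urn μ ν U V W s n ω) * (total (urn μ ν U V W s n ω) + β))) :=
    hwm.mono (h.history.le n) le_rfl
  have hwi : Integrable (fun ω =>
      -(1 / (total (urn μ ν U V W s n ω) * (total (urn μ ν U V W s n ω) + β)))) P :=
    Integrable.of_bound hwm'.aestronglyMeasurable _ (ae_of_all _ hwb)
  have h3 : ∫ ω, -(1 / (total (urn μ ν U V W s n ω) * (total (urn μ ν U V W s n ω) + β))) *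
      mean μ ∂P ≤ -(m₀ * (t / (t + β))) * a ^ 2 := by
    rw [← h2]
    refine integral_mono (hwi.mul_const _)
      ((((hiT n).const_mul (2 * a)).sub (integrable_const (a ^ 2))).const_mul _) fun ω => ?_
    have hT := hTt ω
    simp only
    set T := total (urn μ ν U V W s n ω)
    have hT0 : 0 < T := ht.trans_le hT
    have h4 : t / (t + β) * (1 / T) ^ 2 ≤ 1 / (T * (T + β)) := by
      rw [div_pow, one_pow, div_mul_div_comm, mul_one, div_le_div_iff₀ (by positivity)
        (by positivity)]
      have : 0 ≤ T * β * (T - t) := mul_nonneg (by positivity) (by linarith)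
      nlinarith
    -- Jensen's inequality in tangent-line form: the tangent to the square at `a = E (1 / T)` lies
    -- below it and integrates to `a²`.
    have h5 : 2 * a * (1 / T) - a ^ 2 ≤ (1 / T) ^ 2 := by nlinarith [sq_nonneg (1 / T - a)]
    have h6 : t / (t + β) * (2 * a * (1 / T) - a ^ 2) ≤ 1 / (T * (T + β)) :=
      le_trans (mul_le_mul_of_nonneg_left h5 (by positivity)) h4
    have h7 : m₀ * (t / (t + β) * (2 * a * (1 / T) - a ^ 2)) ≤ mean μ * (1 / (T * (T + β))) :=
      (mul_le_mul_of_nonneg_left h6 hm₀).trans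
        (mul_le_mul_of_nonneg_right hm (by positivity))
    linarith
  have e : ∀ ω, ratio (urn μ ν U V W s n ω) *
      (-(1 / (total (urn μ ν U V W s n ω) * (total (urn μ ν U V W s n ω) + β))) * mean μ) +
      (1 - ratio (urn μ ν U V W s n ω)) *
      (-(1 / (total (urn μ ν U V W s n ω) * (total (urn μ ν U V W s n ω) + β))) * mean ν) =
      -(1 / (total (urn μ ν U V W s n ω) * (total (urn μ ν U V W s n ω) + β))) * mean μ :=
    fun ω => by rw [← hmean]; ring
  simp only [Function.comp_apply, e] at h1
  linarith

/-- The sequence is nonincreasing, so each of the first `n` decrements is at least `κ a_n²`, and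
together they cannot exceed `a_0 - a_n`. -/
lemma mul_sq_le_of_succ_le {a : ℕ → ℝ} {κ : ℝ} (hκ : 0 ≤ κ) (h0 : ∀ n, 0 ≤ a n)
    (h : ∀ n, a (n + 1) ≤ a n - κ * a n ^ 2) (n : ℕ) : n * κ * a n ^ 2 + a n ≤ a 0 := by
  induction n with
  | zero => simp
  | succ n ih =>
    have h1 := h n
    have h2 : a (n + 1) ^ 2 ≤ a n ^ 2 :=
      pow_le_pow_left₀ (h0 _) (h1.trans (sub_le_self _ (by positivity))) 2
    have h3 : (n + 1) * κ * a (n + 1) ^ 2 ≤ (n + 1) * κ * a n ^ 2 := by gcongr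
    push_cast
    linarith

/-- The proportions are Cauchy in `L¹`, uniformly in all the data of the urn. -/
lemma exists_uniform_cauchy (β : ℝ) {m₀ t ε : ℝ} (hm₀ : 0 < m₀) (hβ : 0 ≤ β) (ht : 0 < t)
    (hε : 0 < ε) :
    ∃ N : ℕ, ∀ (μ ν : Distr β), mean μ = mean ν → m₀ ≤ mean μ → ∀ s ∈ Quadrant, t ≤ total s →
      ∀ (Ω : Type u) [MeasurableSpace Ω] (P : Measure Ω) [IsProbabilityMeasure P]
      (U V W : ℕ → Ω → Set.Icc (0 : ℝ) 1), IsUrnInput P U V W → ∀ m, N ≤ m →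
      ∫ ω, |ratio (urn μ ν U V W s m ω) - ratio (urn μ ν U V W s N ω)| ∂P ≤ ε := by
  set κ := m₀ * (t / (t + β)) with hκ
  have hκ0 : 0 < κ := by positivity
  -- Chosen so that `3β η ≤ (ε / 2)²`; the `+ 1` keeps the denominator positive when `β = 0`.
  set η := (ε / 2) ^ 2 / (3 * β + 1) with hη
  have hη0 : 0 < η := by positivity
  obtain ⟨N, hN⟩ := exists_nat_gt (1 / t / (κ * η ^ 2))
  refine ⟨N, fun μ ν hmean hm s hs hts Ω _ P _ U V W h m hNm => ?_⟩
  have ha0 : ∀ n, 0 ≤ ∫ ω, 1 / total (urn μ ν U V W s n ω) ∂P := fun n =>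
    integral_nonneg fun ω => inv_total_urn_nonneg hs n ω
  have h1 := mul_sq_le_of_succ_le hκ0.le ha0
    (fun n => h.integral_inv_total_succ_le hmean hs hm₀.le hm ht hts n) N
  have h2 : ∫ ω, 1 / total (urn μ ν U V W s 0 ω) ∂P ≤ 1 / t := by
    simp only [urn, integral_const, probReal_univ, one_smul]
    exact one_div_le_one_div_of_le ht hts
  have h3 : ∫ ω, 1 / total (urn μ ν U V W s N ω) ∂P ≤ η := by
    by_contra! hlt
    rw [div_lt_iff₀ (by positivity)] at hN
    have : N * κ * η ^ 2 ≤ N * κ * (∫ ω, 1 / total (urn μ ν U V W s N ω) ∂P) ^ 2 := by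
      gcongr
    linarith [ha0 N]
  have h4 := (h.integral_ratio_sub_sq_le hmean hs hNm).trans
    (mul_le_mul_of_nonneg_left h3 (by positivity))
  have h5 : 3 * β * η ≤ (ε / 2) ^ 2 := by
    rw [hη, ← mul_div_assoc, div_le_iff₀ (by positivity)]
    nlinarith [sq_nonneg (ε / 2)]
  have h6 : ∫ ω, |ratio (urn μ ν U V W s m ω) - ratio (urn μ ν U V W s N ω)| ∂P ≤
      ∫ ω, (ε / 2 + 2 / ε *
        (ratio (urn μ ν U V W s m ω) - ratio (urn μ ν U V W s N ω)) ^ 2) ∂P := by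
    refine integral_mono ((h.integrable_ratio hs m).sub (h.integrable_ratio hs N)).abs
      ((integrable_const _).add ((h.integrable_ratio_sub_sq hs m N).const_mul _)) fun ω => ?_
    simp only
    rw [← sq_abs]
    set x := |ratio (urn μ ν U V W s m ω) - ratio (urn μ ν U V W s N ω)|
    -- Completing the square gives `x ≤ ε / 2 + (2 / ε) x²`, which passes from the `L²` bound to an
    -- `L¹` bound without Cauchy–Schwarz.
    have : ε / 2 + 2 / ε * x ^ 2 - x = 2 / ε * ((x - ε / 4) ^ 2 + 3 * ε ^ 2 / 16) := by
      field_simp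
      ring
    have : 0 ≤ 2 / ε * ((x - ε / 4) ^ 2 + 3 * ε ^ 2 / 16) := by positivity
    linarith
  rw [integral_add (integrable_const _) ((h.integrable_ratio_sub_sq hs m N).const_mul _),
    integral_const_mul] at h6
  simp only [integral_const, probReal_univ, one_smul] at h6
  refine h6.trans ?_
  calc ε / 2 + 2 / ε * ∫ ω, (ratio (urn μ ν U V W s m ω) - ratio (urn μ ν U V W s N ω)) ^ 2 ∂P
      ≤ ε / 2 + 2 / ε * (ε / 2) ^ 2 := by
        have := h4.trans h5
        gcongr
    _ = ε := by field_simp; ring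

end Convergence

/-! ### Two urns driven by the same input -/

section Coupling

variable {β : ℝ} {Ω : Type u} [mΩ : MeasurableSpace Ω] {P : Measure Ω}
  {U V W : ℕ → Ω → Set.Icc (0 : ℝ) 1} {μ ν μ' ν' : Distr β} {s s' : ℝ × ℝ}

/-- The Manhattan distance of two compositions. -/
def distL1 (c d : ℝ × ℝ) : ℝ := |c.1 - d.1| + |c.2 - d.2|

lemma distL1_nonneg (c d : ℝ × ℝ) : 0 ≤ distL1 c d := add_nonneg (abs_nonneg _) (abs_nonneg _)

/-- Over the common denominator the numerator is at most `distL1 c d * total d`, so `total d`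
cancels and a lower bound on one of the two contents suffices. -/
lemma abs_ratio_sub_le_distL1 {c d : ℝ × ℝ} (hc : c ∈ Quadrant) (hd : d ∈ Quadrant) :
    |ratio c - ratio d| ≤ distL1 c d / total c := by
  have h1 := total_pos hc
  have h2 := total_pos hd
  have hd1 : 0 ≤ d.1 := hd.1.1
  have hd2 : 0 ≤ d.2 := hd.1.2
  have e : ratio c - ratio d = ((c.1 - d.1) * d.2 - d.1 * (c.2 - d.2)) / (total c * total d) := by
    unfold total at *
    unfold ratio
    field_simp
    ring
  rw [e, abs_div, abs_of_pos (mul_pos h1 h2), div_le_div_iff₀ (mul_pos h1 h2) h1]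
  have : |(c.1 - d.1) * d.2 - d.1 * (c.2 - d.2)| ≤ distL1 c d * total d := by
    refine (abs_sub _ _).trans ?_
    rw [abs_mul, abs_mul, abs_of_nonneg hd1, abs_of_nonneg hd2]
    unfold distL1 total
    nlinarith [mul_nonneg (abs_nonneg (c.1 - d.1)) hd1, mul_nonneg (abs_nonneg (c.2 - d.2)) hd2]
  nlinarith

/-- If the colours agree, only the quantile difference of that colour is added. If they disagree,
each urn adds at most `β`, in different coordinates, whence `2β`. -/
lemma distL1_step_le (μ ν μ' ν' : Distr β) (c d : ℝ × ℝ)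
    (r : Set.Icc (0 : ℝ) 1 × Set.Icc (0 : ℝ) 1 × Set.Icc (0 : ℝ) 1) :
    distL1 (step μ ν c r) (step μ' ν' d r) ≤ distL1 c d +
      |quantile μ r.2.1 - quantile μ' r.2.1| + |quantile ν r.2.2 - quantile ν' r.2.2| +
      2 * β * |{r | (r.1 : ℝ) ≤ ratio c}.indicator 1 r - {r | (r.1 : ℝ) ≤ ratio d}.indicator 1 r|
      := by
  have a1 : ∀ (ξ : Distr β) v, |quantile ξ v| ≤ β := fun ξ v => by
    rw [abs_of_nonneg (quantile_nonneg _ _)]; exact quantile_le _ _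
  have n1 := abs_nonneg (quantile μ r.2.1 - quantile μ' r.2.1)
  have n2 := abs_nonneg (quantile ν r.2.2 - quantile ν' r.2.2)
  have tri : ∀ x y z : ℝ, |x + y - z| ≤ |x - z| + |y| := fun x y z => by
    rw [add_sub_right_comm]; exact abs_add_le _ _
  have tri' : ∀ x y z : ℝ, |x - (y + z)| ≤ |x - y| + |z| := fun x y z => by
    rw [← sub_sub]; exact abs_sub _ _
  unfold step distL1
  by_cases h1 : (r.1 : ℝ) ≤ ratio c <;> by_cases h2 : (r.1 : ℝ) ≤ ratio d <;>
    simp only [h1, h2, if_true, if_false, Set.indicator, Set.mem_ofPred_eq, Pi.one_apply, sub_self,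
      sub_zero, zero_sub, abs_neg, abs_one, abs_zero, mul_one, mul_zero, add_zero]
  · have : |c.1 + quantile μ r.2.1 - (d.1 + quantile μ' r.2.1)| ≤
        |c.1 - d.1| + |quantile μ r.2.1 - quantile μ' r.2.1| := by
      rw [add_sub_add_comm]; exact abs_add_le _ _
    linarith
  · linarith [tri c.1 (quantile μ r.2.1) d.1, tri' c.2 d.2 (quantile ν' r.2.2), a1 μ r.2.1,
      a1 ν' r.2.2]
  · linarith [tri' c.1 d.1 (quantile μ' r.2.1), tri c.2 (quantile ν r.2.2) d.2, a1 μ' r.2.1,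
      a1 ν r.2.2]
  · have : |c.2 + quantile ν r.2.2 - (d.2 + quantile ν' r.2.2)| ≤
        |c.2 - d.2| + |quantile ν r.2.2 - quantile ν' r.2.2| := by
      rw [add_sub_add_comm]; exact abs_add_le _ _
    linarith

lemma IsUrnInput.measureReal_input_le (h : IsUrnInput P U V W) (n : ℕ) {z : ℝ}
    (hz : z ∈ Set.Icc (0 : ℝ) 1) : (P.map (input U V W n)).real {r | (r.1 : ℝ) ≤ z} = z := by
  have hm : MeasurableSet {v : Set.Icc (0 : ℝ) 1 | (v : ℝ) ≤ z} :=
    measurableSet_le measurable_subtype_coe measurable_const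
  refine Eq.trans ?_ (volume_real_coe_le hz.1 hz.2)
  rw [← h.map_U n, map_measureReal_apply (h.measurable_U n) hm]
  exact map_measureReal_apply (h.measurable_input n) (measurable_fst hm)

lemma measurable_indicator_le_ratio : Measurable fun p : (ℝ × ℝ) ×
    (Set.Icc (0 : ℝ) 1 × Set.Icc (0 : ℝ) 1 × Set.Icc (0 : ℝ) 1) =>
    {r : Set.Icc (0 : ℝ) 1 × Set.Icc (0 : ℝ) 1 × Set.Icc (0 : ℝ) 1 |
      (r.1 : ℝ) ≤ ratio p.1}.indicator (1 : _ × _ × _ → ℝ) p.2 := by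
  have h3 := measurable_ratio
  exact ((measurable_const (a := (1 : ℝ))).indicator (s := {p : (ℝ × ℝ) ×
    (Set.Icc (0 : ℝ) 1 × Set.Icc (0 : ℝ) 1 × Set.Icc (0 : ℝ) 1) | (p.2.1 : ℝ) ≤ ratio p.1})
      (measurableSet_le (by fun_prop) (by fun_prop)) : _)

lemma measurable_distL1 : Measurable fun p : (ℝ × ℝ) × (ℝ × ℝ) => distL1 p.1 p.2 := by
  unfold distL1
  fun_prop

lemma integrable_abs_quantile_sub (ξ ξ' : Distr β) :
    Integrable (fun v => |quantile ξ v - quantile ξ' v|) volume := by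
  have hi : ∀ ξ : Distr β, Integrable (quantile ξ) volume := fun ξ =>
    Integrable.of_bound (measurable_quantile ξ).aestronglyMeasurable β (ae_of_all _ fun v => by
      rw [Real.norm_eq_abs, abs_of_nonneg (quantile_nonneg _ _)]; exact quantile_le _ _)
  exact ((hi ξ).sub (hi ξ')).abs

lemma integrable_and_integral_quantile_comp {X : Ω → Set.Icc (0 : ℝ) 1} (hX : Measurable X)
    (hmap : P.map X = volume) (ξ ξ' : Distr β) :
    Integrable (fun ω => |quantile ξ (X ω) - quantile ξ' (X ω)|) P ∧
      ∫ ω, |quantile ξ (X ω) - quantile ξ' (X ω)| ∂P = dW ξ ξ' := by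
  have hm : Measurable fun v => |quantile ξ v - quantile ξ' v| :=
    ((measurable_quantile ξ).sub (measurable_quantile ξ')).abs
  have hi := integrable_abs_quantile_sub ξ ξ'
  rw [← integral_abs_quantile_sub, ← hmap, integral_map hX.aemeasurable hm.aestronglyMeasurable]
  rw [← hmap, integrable_map_measure hm.aestronglyMeasurable hX.aemeasurable] at hi
  exact ⟨hi, rfl⟩

variable [IsProbabilityMeasure P]

/-- The probability that two urns driven by the same input add different colours. -/
lemma IsUrnInput.integral_abs_indicator_sub (h : IsUrnInput P U V W) (hs : s ∈ Quadrant)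
    (hs' : s' ∈ Quadrant) (n : ℕ) :
    Integrable (fun ω =>
      |{r | (r.1 : ℝ) ≤ ratio (urn μ ν U V W s n ω)}.indicator (1 : _ × _ × _ → ℝ) (input U V W n ω) -
      {r | (r.1 : ℝ) ≤ ratio (urn μ' ν' U V W s' n ω)}.indicator 1 (input U V W n ω)|) P ∧
    ∫ ω, |{r | (r.1 : ℝ) ≤ ratio (urn μ ν U V W s n ω)}.indicator (1 : _ × _ × _ → ℝ) (input U V W n ω) -
      {r | (r.1 : ℝ) ≤ ratio (urn μ' ν' U V W s' n ω)}.indicator 1 (input U V W n ω)| ∂P =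
      ∫ ω, |ratio (urn μ ν U V W s n ω) - ratio (urn μ' ν' U V W s' n ω)| ∂P := by
  let φ : (ℝ × ℝ) × (ℝ × ℝ) → Set.Icc (0 : ℝ) 1 × Set.Icc (0 : ℝ) 1 × Set.Icc (0 : ℝ) 1 → ℝ :=
    fun c r => |{r : Set.Icc (0 : ℝ) 1 × Set.Icc (0 : ℝ) 1 × Set.Icc (0 : ℝ) 1 |
        (r.1 : ℝ) ≤ ratio c.1}.indicator (1 : _ × _ × _ → ℝ) r -
      {r : Set.Icc (0 : ℝ) 1 × Set.Icc (0 : ℝ) 1 × Set.Icc (0 : ℝ) 1 |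
        (r.1 : ℝ) ≤ ratio c.2}.indicator (1 : _ × _ × _ → ℝ) r|
  have hφ : Measurable (Function.uncurry φ) :=
    ((measurable_indicator_le_ratio.comp
      ((measurable_fst.comp measurable_fst).prodMk measurable_snd)).sub
      (measurable_indicator_le_ratio.comp
      ((measurable_snd.comp measurable_fst).prodMk measurable_snd))).abs
  have hX : Measurable[h.history n] fun ω => (urn μ ν U V W s n ω, urn μ' ν' U V W s' n ω) :=
    (h.measurable_urn_history μ ν s n).prodMk (h.measurable_urn_history μ' ν' s' n)
  have hint : Integrable (fun ω => φ (urn μ ν U V W s n ω, urn μ' ν' U V W s' n ω)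
      (input U V W n ω)) P := by
    refine Integrable.of_bound (C := 1) (hφ.comp
      ((hX.mono (h.history.le n) le_rfl).prodMk (h.measurable_input n))).aestronglyMeasurable
      (ae_of_all _ fun ω => ?_)
    simp only [φ, Set.indicator, Real.norm_eq_abs, abs_abs]
    split_ifs <;> simp
  refine ⟨hint, (h.integral_comp_input hX hφ hint).trans (integral_congr_ae
    (ae_of_all _ fun ω => ?_))⟩
  have := Measure.isProbabilityMeasure_map (μ := P) (h.measurable_input n).aemeasurable
  have hm : ∀ z : ℝ, MeasurableSet {r : Set.Icc (0 : ℝ) 1 × Set.Icc (0 : ℝ) 1 × Set.Icc (0 : ℝ) 1 |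
      (r.1 : ℝ) ≤ z} := fun z => measurableSet_le (by fun_prop) (by fun_prop)
  simp only [φ]
  -- Both colour choices compare the same uniform variable with a threshold, so the events are
  -- nested and differ with probability equal to the gap of the thresholds.
  rw [RRU.integral_abs_indicator_sub _ (hm _) (hm _),
    h.measureReal_input_le n (ratio_mem (urn_mem μ ν hs n ω)),
    h.measureReal_input_le n (ratio_mem (urn_mem μ' ν' hs' n ω))]
  rcases le_total (ratio (urn μ ν U V W s n ω)) (ratio (urn μ' ν' U V W s' n ω)) with hle | hle
  · exact Or.inl fun v hv => le_trans hv hle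
  · exact Or.inr fun v hv => le_trans hv hle

/-- Urns driven by the same input stay close to each other for a bounded time. -/
lemma IsUrnInput.integral_distL1_le (h : IsUrnInput P U V W) (hs : s ∈ Quadrant)
    (hs' : s' ∈ Quadrant) {t : ℝ} (ht : 0 < t) (hts : t ≤ total s) (n : ℕ) :
    Integrable (fun ω => distL1 (urn μ ν U V W s n ω) (urn μ' ν' U V W s' n ω)) P ∧
    ∫ ω, distL1 (urn μ ν U V W s n ω) (urn μ' ν' U V W s' n ω) ∂P ≤
      (1 + 2 * β / t) ^ n * (distL1 s s' + n * (dW μ μ' + dW ν ν')) := by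
  have hβ := μ.nonneg
  induction n with
  | zero => exact ⟨integrable_const (distL1 s s'), by simp [urn]⟩
  | succ n ih =>
    obtain ⟨ih1, ih2⟩ := ih
    obtain ⟨hV1, hV2⟩ := integrable_and_integral_quantile_comp (h.measurable_V n) (h.map_V n) μ μ'
    obtain ⟨hW1, hW2⟩ := integrable_and_integral_quantile_comp (h.measurable_W n) (h.map_W n) ν ν'
    obtain ⟨hI1, hI2⟩ := h.integral_abs_indicator_sub (μ := μ) (ν := ν) (μ' := μ') (ν' := ν')
      hs hs' n
    have hg := ((ih1.add hV1).add hW1).add (hI1.const_mul (2 * β))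
    have hle : ∀ ω, distL1 (urn μ ν U V W s (n + 1) ω) (urn μ' ν' U V W s' (n + 1) ω) ≤ _ :=
      fun ω => distL1_step_le μ ν μ' ν' (urn μ ν U V W s n ω) (urn μ' ν' U V W s' n ω)
        (input U V W n ω)
    have hint : Integrable (fun ω => distL1 (urn μ ν U V W s (n + 1) ω)
        (urn μ' ν' U V W s' (n + 1) ω)) P := by
      refine hg.mono' (measurable_distL1.comp ((h.measurable_urn μ ν s (n + 1)).prodMk
        (h.measurable_urn μ' ν' s' (n + 1)))).aestronglyMeasurable (ae_of_all _ fun ω => ?_)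
      rw [Real.norm_eq_abs, abs_of_nonneg (distL1_nonneg _ _)]
      exact hle ω
    refine ⟨hint, (integral_mono hint hg hle).trans ?_⟩
    have hr : ∫ ω, |ratio (urn μ ν U V W s n ω) - ratio (urn μ' ν' U V W s' n ω)| ∂P ≤
        ∫ ω, distL1 (urn μ ν U V W s n ω) (urn μ' ν' U V W s' n ω) / t ∂P := by
      refine integral_mono ((h.integrable_ratio hs n).sub (h.integrable_ratio hs' n)).abs
        (ih1.div_const t) fun ω => ?_
      refine (abs_ratio_sub_le_distL1 (urn_mem μ ν hs n ω) (urn_mem μ' ν' hs' n ω)).trans ?_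
      exact div_le_div_of_nonneg_left (distL1_nonneg _ _) ht
        (hts.trans (total_le_total_urn μ ν s n ω))
    rw [integral_div] at hr
    rw [integral_add' ((ih1.add hV1).add hW1) (hI1.const_mul (2 * β)),
      integral_add' (ih1.add hV1) hW1, integral_add' ih1 hV1, hV2, hW2, integral_const_mul, hI2]
    set D := ∫ ω, distL1 (urn μ ν U V W s n ω) (urn μ' ν' U V W s' n ω) ∂P
    have hd : 0 ≤ dW μ μ' + dW ν ν' := add_nonneg (dW_nonneg _ _) (dW_nonneg _ _)
    -- The growth factor is at least one, so the newly added Wasserstein term can be multiplied by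
    -- its power `n + 1` to keep the bound in closed form.
    have hL : 1 ≤ 1 + 2 * β / t := le_add_of_nonneg_right (by positivity)
    calc D + dW μ μ' + dW ν ν' + 2 * β * _ ≤ D + dW μ μ' + dW ν ν' + 2 * β * (D / t) := by gcongr
      _ = (1 + 2 * β / t) * D + 1 * (dW μ μ' + dW ν ν') := by ring
      _ ≤ (1 + 2 * β / t) * ((1 + 2 * β / t) ^ n * (distL1 s s' + n * (dW μ μ' + dW ν ν'))) +
          (1 + 2 * β / t) ^ (n + 1) * (dW μ μ' + dW ν ν') := by
        gcongr
        exact one_le_pow₀ hL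
      _ = _ := by push_cast; ring

end Coupling

/-- The limit proportion depends uniformly continuously on the parameters and on the initial
composition, away from the empty urn. -/
lemma exists_uniform_close (β : ℝ) {m₀ t ε : ℝ} (hm₀ : 0 < m₀) (hβ : 0 ≤ β) (ht : 0 < t)
    (hε : 0 < ε) :
    ∃ δ : ℝ, 0 < δ ∧ ∀ μ ν μ' ν' : Distr β, mean μ = mean ν → m₀ ≤ mean μ → mean μ' = mean ν' →
      m₀ ≤ mean μ' → ∀ s ∈ Quadrant, ∀ s' ∈ Quadrant, t ≤ total s → t ≤ total s' →
      distL1 s s' + (dW μ μ' + dW ν ν') < δ →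
      ∀ (Ω : Type u) [MeasurableSpace Ω] (P : Measure Ω) [IsProbabilityMeasure P]
      (U V W : ℕ → Ω → Set.Icc (0 : ℝ) 1), IsUrnInput P U V W → ∀ Z Z' : Ω → ℝ,
      (∀ᵐ ω ∂P, Tendsto (fun n => ratio (urn μ ν U V W s n ω)) atTop (𝓝 (Z ω))) →
      (∀ᵐ ω ∂P, Tendsto (fun n => ratio (urn μ' ν' U V W s' n ω)) atTop (𝓝 (Z' ω))) →
      ∫ ω, |Z ω - Z' ω| ∂P ≤ ε := by
  obtain ⟨N, hN⟩ := exists_uniform_cauchy.{u} β hm₀ hβ ht (by positivity : 0 < ε / 4)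
  -- This `δ` makes the expected distance at time `N` at most `ε t / 4`, hence the proportions there
  -- `ε / 4`-close. Two further `ε / 4` come from moving each urn to a later time.
  refine ⟨ε / 4 * t / ((1 + 2 * β / t) ^ N * (N + 1)), by positivity, ?_⟩
  intro μ ν μ' ν' hmean hm hmean' hm' s hs s' hs' hts hts' hδ Ω _ P _ U V W h Z Z' hZ hZ'
  have hR := h.integrable_ratio (μ := μ) (ν := ν) hs
  have hR' := h.integrable_ratio (μ := μ') (ν := ν') hs'
  have hD := h.integral_distL1_le (μ := μ) (ν := ν) (μ' := μ') (ν' := ν') hs hs' ht hts N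
  have hN0 : ∫ ω, |ratio (urn μ ν U V W s N ω) - ratio (urn μ' ν' U V W s' N ω)| ∂P ≤ ε / 4 := by
    have hr : ∫ ω, |ratio (urn μ ν U V W s N ω) - ratio (urn μ' ν' U V W s' N ω)| ∂P ≤
        ∫ ω, distL1 (urn μ ν U V W s N ω) (urn μ' ν' U V W s' N ω) / t ∂P := by
      refine integral_mono ((hR N).sub (hR' N)).abs (hD.1.div_const t) fun ω => ?_
      refine (abs_ratio_sub_le_distL1 (urn_mem μ ν hs N ω) (urn_mem μ' ν' hs' N ω)).trans ?_
      exact div_le_div_of_nonneg_left (distL1_nonneg _ _) ht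
        (hts.trans (total_le_total_urn μ ν s N ω))
    rw [integral_div] at hr
    refine hr.trans ((div_le_iff₀ ht).2 (hD.2.trans ?_))
    rw [lt_div_iff₀ (by positivity)] at hδ
    have h1 : distL1 s s' + N * (dW μ μ' + dW ν ν') ≤
        (N + 1) * (distL1 s s' + (dW μ μ' + dW ν ν')) := by
      have := distL1_nonneg s s'
      have := dW_nonneg μ μ'
      have := dW_nonneg ν ν'
      have : 0 ≤ N * distL1 s s' := by positivity
      nlinarith
    calc (1 + 2 * β / t) ^ N * (distL1 s s' + N * (dW μ μ' + dW ν ν'))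
        ≤ (1 + 2 * β / t) ^ N * ((N + 1) * (distL1 s s' + (dW μ μ' + dW ν ν'))) := by gcongr
      _ = (distL1 s s' + (dW μ μ' + dW ν ν')) * ((1 + 2 * β / t) ^ N * (N + 1)) := by ring
      _ ≤ ε / 4 * t := hδ.le
  have hm1 : ∀ m, N ≤ m →
      ∫ ω, |ratio (urn μ ν U V W s m ω) - ratio (urn μ' ν' U V W s' m ω)| ∂P ≤ ε := by
    intro m hNm
    have h1 := hN μ ν hmean hm s hs hts Ω P U V W h m hNm
    have h2 := hN μ' ν' hmean' hm' s' hs' hts' Ω P U V W h m hNm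
    have i1 : Integrable (fun ω =>
        |ratio (urn μ ν U V W s m ω) - ratio (urn μ ν U V W s N ω)|) P := ((hR m).sub (hR N)).abs
    have i2 : Integrable (fun ω => |ratio (urn μ' ν' U V W s' m ω) -
        ratio (urn μ' ν' U V W s' N ω)|) P := ((hR' m).sub (hR' N)).abs
    have i3 : Integrable (fun ω => |ratio (urn μ ν U V W s N ω) -
        ratio (urn μ' ν' U V W s' N ω)|) P := ((hR N).sub (hR' N)).abs
    have i12 : Integrable (fun ω => |ratio (urn μ ν U V W s m ω) - ratio (urn μ ν U V W s N ω)| +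
        |ratio (urn μ' ν' U V W s' m ω) - ratio (urn μ' ν' U V W s' N ω)|) P := i1.add i2
    have h3 : ∫ ω, |ratio (urn μ ν U V W s m ω) - ratio (urn μ' ν' U V W s' m ω)| ∂P ≤ _ :=
      integral_mono ((hR m).sub (hR' m)).abs (i12.add i3) fun ω => by
        simp only [Pi.add_apply]
        set a := ratio (urn μ ν U V W s m ω)
        set b := ratio (urn μ' ν' U V W s' m ω)
        set c := ratio (urn μ ν U V W s N ω)
        set d := ratio (urn μ' ν' U V W s' N ω)
        have e : a - b = (a - c) - (b - d) + (c - d) := by ring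
        rw [e]
        exact (abs_add_le _ _).trans (add_le_add_left (abs_sub _ _) _)
    simp only [Pi.add_apply] at h3
    rw [integral_add i12 i3, integral_add i1 i2] at h3
    linarith
  -- The bound holds for every `m ≥ N`, and differences of proportions are bounded by `1`, so it
  -- passes to the limits.
  refine le_of_tendsto (tendsto_integral_of_dominated_convergence (fun _ => (1 : ℝ))
    (fun m => ((hR m).sub (hR' m)).abs.aestronglyMeasurable) (integrable_const _)
    (fun m => ae_of_all _ fun ω => ?_) ?_) (eventually_atTop.2 ⟨N, hm1⟩)
  · rw [Real.norm_eq_abs, abs_abs]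
    exact abs_ratio_sub_le (urn_mem μ ν hs m ω) (urn_mem μ' ν' hs' m ω)
  · filter_upwards [hZ, hZ'] with ω h1 h2
    exact (h1.sub h2).abs

/-! ### The limit law does not depend on the probability space -/

section Law

variable {β : ℝ} {Ω Ω' : Type u} [MeasurableSpace Ω] [MeasurableSpace Ω'] {P : Measure Ω}
  {P' : Measure Ω'} [IsProbabilityMeasure P] [IsProbabilityMeasure P']
  {U V W : ℕ → Ω → Set.Icc (0 : ℝ) 1} {U' V' W' : ℕ → Ω' → Set.Icc (0 : ℝ) 1}
  {μ ν : Distr β} {s : ℝ × ℝ}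

/-- The transition operator of the urn. -/
noncomputable def transition (μ ν : Distr β) (g : ℝ × ℝ → ℝ) (c : ℝ × ℝ) : ℝ :=
  ratio c * (∫ v, g (c.1 + quantile μ v, c.2)) + (1 - ratio c) * ∫ w, g (c.1, c.2 + quantile ν w)

lemma measurable_transition (μ ν : Distr β) {g : ℝ × ℝ → ℝ} (hg : Measurable g) :
    Measurable (transition μ ν g) := by
  have h1 := measurable_quantile μ
  have h2 := measurable_quantile ν
  have m1 : Measurable fun p : (ℝ × ℝ) × Set.Icc (0 : ℝ) 1 => g (p.1.1 + quantile μ p.2, p.1.2) := by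
    fun_prop
  have m2 : Measurable fun p : (ℝ × ℝ) × Set.Icc (0 : ℝ) 1 => g (p.1.1, p.1.2 + quantile ν p.2) := by
    fun_prop
  exact (measurable_ratio.mul m1.stronglyMeasurable.integral_prod_right'.measurable).add
    ((measurable_const.sub measurable_ratio).mul
      m2.stronglyMeasurable.integral_prod_right'.measurable)

/-- The operator `transition` involves only `μ` and `ν`, so the law at time `n` determines the law
at time `n + 1` whatever the input. -/
lemma IsUrnInput.integral_urn_succ (h : IsUrnInput P U V W) (hs : s ∈ Quadrant) {g : ℝ × ℝ → ℝ}
    (hg : Measurable g) {C : ℝ} (hC : ∀ c, |g c| ≤ C) (n : ℕ) :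
    ∫ ω, g (urn μ ν U V W s (n + 1) ω) ∂P = ∫ c, transition μ ν g c ∂(P.map (urn μ ν U V W s n)) := by
  have h1 := measurable_quantile μ
  have h2 := measurable_quantile ν
  rw [integral_map (h.measurable_urn μ ν s n).aemeasurable
    (measurable_transition μ ν hg).aestronglyMeasurable]
  refine (h.integral_comp_input (h.measurable_urn_history μ ν s n)
    (φ := fun c r => g (step μ ν c r)) (hg.comp (measurable_step μ ν)) ?_).trans
    (integral_congr_ae (ae_of_all _ fun ω => ?_))
  · exact Integrable.of_bound (hg.comp (h.measurable_urn μ ν s (n + 1))).aestronglyMeasurable C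
      (ae_of_all _ fun ω => hC _)
  · simp only [step, apply_ite g]
    exact h.integral_input_ite n (ratio_mem (urn_mem μ ν hs n ω))
      (f := fun v => g ((urn μ ν U V W s n ω).1 + quantile μ v, (urn μ ν U V W s n ω).2))
      (g := fun w => g ((urn μ ν U V W s n ω).1, (urn μ ν U V W s n ω).2 + quantile ν w))
      (by fun_prop) (by fun_prop) (fun _ => hC _) (fun _ => hC _)

/-- The law of the composition at a fixed time does not depend on the input. -/
lemma map_urn_eq (h : IsUrnInput P U V W) (h' : IsUrnInput P' U' V' W') (hs : s ∈ Quadrant)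
    (n : ℕ) : P.map (urn μ ν U V W s n) = P'.map (urn μ ν U' V' W' s n) := by
  induction n with
  | zero =>
    change P.map (fun _ => s) = P'.map (fun _ => s)
    simp
  | succ n ih =>
    ext A hA
    have hm := h.measurable_urn μ ν s (n + 1)
    have hm' := h'.measurable_urn μ ν s (n + 1)
    have := Measure.isProbabilityMeasure_map (μ := P) hm.aemeasurable
    have := Measure.isProbabilityMeasure_map (μ := P') hm'.aemeasurable
    rw [← ENNReal.toReal_eq_toReal_iff' (measure_ne_top _ _) (measure_ne_top _ _)]
    change (P.map _).real A = (P'.map _).real A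
    have hg : Measurable (A.indicator (1 : ℝ × ℝ → ℝ)) := measurable_const.indicator hA
    have hC : ∀ c, |A.indicator (1 : ℝ × ℝ → ℝ) c| ≤ 1 := fun c => by
      by_cases hc : c ∈ A <;> simp [hc]
    rw [← integral_indicator_one hA, ← integral_indicator_one hA,
      integral_map hm.aemeasurable hg.aestronglyMeasurable,
      integral_map hm'.aemeasurable hg.aestronglyMeasurable]
    exact (h.integral_urn_succ hs hg hC n).trans (ih ▸ (h'.integral_urn_succ hs hg hC n).symm)

/-- The law of the limit proportion does not depend on the input. -/
lemma map_limit_eq (h : IsUrnInput P U V W) (h' : IsUrnInput P' U' V' W') (hs : s ∈ Quadrant)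
    {Z : Ω → Set.Icc (0 : ℝ) 1} {Z' : Ω' → Set.Icc (0 : ℝ) 1} (hZm : Measurable Z)
    (hZm' : Measurable Z')
    (hZ : ∀ᵐ ω ∂P, Tendsto (fun n => ratio (urn μ ν U V W s n ω)) atTop (𝓝 (Z ω : ℝ)))
    (hZ' : ∀ᵐ ω ∂P', Tendsto (fun n => ratio (urn μ ν U' V' W' s n ω)) atTop (𝓝 (Z' ω : ℝ))) :
    P.map Z = P'.map Z' := by
  have := Measure.isProbabilityMeasure_map (μ := P) hZm.aemeasurable
  have := Measure.isProbabilityMeasure_map (μ := P') hZm'.aemeasurable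
  refine ext_of_forall_integral_eq_of_IsFiniteMeasure fun f => ?_
  -- The proportion is typed as a real number, so the test function is extended to the line by
  -- clamping.
  let f' : ℝ → ℝ := fun x => f (Set.projIcc 0 1 zero_le_one x)
  have hf' : Continuous f' := f.continuous.comp continuous_projIcc
  have key : ∀ {Ω : Type u} [MeasurableSpace Ω] {P : Measure Ω} [IsProbabilityMeasure P]
      {U V W : ℕ → Ω → Set.Icc (0 : ℝ) 1} {Z : Ω → Set.Icc (0 : ℝ) 1}, IsUrnInput P U V W →
      (∀ᵐ ω ∂P, Tendsto (fun n => ratio (urn μ ν U V W s n ω)) atTop (𝓝 (Z ω : ℝ))) →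
      Tendsto (fun n => ∫ c, f' (ratio c) ∂(P.map (urn μ ν U V W s n))) atTop
        (𝓝 (∫ ω, f (Z ω) ∂P)) := by
    intro Ω _ P _ U V W Z h hZ
    have e : ∀ n, ∫ c, f' (ratio c) ∂(P.map (urn μ ν U V W s n)) =
        ∫ ω, f' (ratio (urn μ ν U V W s n ω)) ∂P := fun n =>
      integral_map (h.measurable_urn μ ν s n).aemeasurable
        (hf'.measurable.comp measurable_ratio).aestronglyMeasurable
    simp_rw [e]
    refine tendsto_integral_of_dominated_convergence (fun _ => ‖f‖) (fun n =>
      (hf'.measurable.comp (measurable_ratio.comp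
        (h.measurable_urn μ ν s n))).aestronglyMeasurable) (integrable_const _)
      (fun n => ae_of_all _ fun ω => f.norm_coe_le_norm _) ?_
    filter_upwards [hZ] with ω hω
    have := (hf'.tendsto _).comp hω
    simpa [f', Function.comp_def] using this
  rw [integral_map hZm.aemeasurable f.continuous.measurable.aestronglyMeasurable,
    integral_map hZm'.aemeasurable f.continuous.measurable.aestronglyMeasurable]
  have h1 := key h hZ
  simp_rw [map_urn_eq h h' hs] at h1
  exact tendsto_nhds_unique h1 (key h' hZ')

end Law

/-! ### Existence, continuity in the initial composition, and the metric on maps -/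

lemma exists_isLimitLaw {β : ℝ} {μ ν : Distr β} (hmean : mean μ = mean ν) {s : ℝ × ℝ}
    (hs : s ∈ Quadrant) : ∃ π : Distr 1, IsLimitLaw.{u} μ ν s π := by
  obtain ⟨Ω, _, P, U, V, W, _, h⟩ := exists_isUrnInput.{u}
  obtain ⟨Z, hZm, hZ⟩ := h.exists_limit hmean hs
  refine ⟨⟨P.map Z, Measure.isProbabilityMeasure_map hZm.aemeasurable⟩, ?_⟩
  intro Ω' _ P' _ U' V' W' h'
  obtain ⟨Z', hZm', hZ'⟩ := h'.exists_limit hmean hs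
  exact ⟨Z', hZm', hZ', map_limit_eq h' h hs hZm' hZm hZ' hZ⟩

/-- Limit laws for close data can be coupled closely. -/
lemma exists_coupling (β : ℝ) {m₀ t ε : ℝ} (hm₀ : 0 < m₀) (hβ : 0 ≤ β) (ht : 0 < t)
    (hε : 0 < ε) :
    ∃ δ : ℝ, 0 < δ ∧ ∀ μ ν μ' ν' : Distr β, mean μ = mean ν → m₀ ≤ mean μ → mean μ' = mean ν' →
      m₀ ≤ mean μ' → ∀ s ∈ Quadrant, ∀ s' ∈ Quadrant, t ≤ total s → t ≤ total s' →
      distL1 s s' + (dW μ μ' + dW ν ν') < δ →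
      ∀ π π' : Distr 1, IsLimitLaw.{u} μ ν s π → IsLimitLaw.{u} μ' ν' s' π' →
      ∃ (Ω : Type u) (_ : MeasurableSpace Ω) (P : Measure Ω) (Z Z' : Ω → Set.Icc (0 : ℝ) 1),
        IsProbabilityMeasure P ∧ Measurable Z ∧ Measurable Z' ∧
        P.map Z = (π : Measure (Set.Icc (0 : ℝ) 1)) ∧
        P.map Z' = (π' : Measure (Set.Icc (0 : ℝ) 1)) ∧ ∫ ω, |(Z ω : ℝ) - Z' ω| ∂P ≤ ε := by
  obtain ⟨δ, hδ, H⟩ := exists_uniform_close.{u} β hm₀ hβ ht hε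
  refine ⟨δ, hδ, fun μ ν μ' ν' h1 h2 h3 h4 s hs s' hs' hts hts' hd π π' hπ hπ' => ?_⟩
  obtain ⟨Ω, _, P, U, V, W, _, h⟩ := exists_isUrnInput.{u}
  obtain ⟨Z, hZm, hZ, hmap⟩ := hπ Ω P U V W h
  obtain ⟨Z', hZm', hZ', hmap'⟩ := hπ' Ω P U V W h
  exact ⟨Ω, _, P, Z, Z', inferInstance, hZm, hZm', hmap, hmap',
    H μ ν μ' ν' h1 h2 h3 h4 s hs s' hs' hts hts' hd Ω P U V W h _ _ hZ hZ'⟩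

/-- This is `exists_coupling` with the same parameters for both urns. Near `s₀` the content exceeds
half that of `s₀`, and weak convergence is tested on Lipschitz functions, for which an `L¹`-close
coupling suffices. -/
lemma continuous_of_isLimitLaw {β : ℝ} {m₀ : ℝ} (hm₀ : 0 < m₀) {μ ν : Distr β}
    (hmean : mean μ = mean ν) (hm : m₀ ≤ mean μ) {F : Quadrant → Distr 1}
    (hF : ∀ s : Quadrant, IsLimitLaw.{u} μ ν (s : ℝ × ℝ) (F s)) : Continuous F := by
  rw [continuous_iff_continuousAt]
  intro s₀
  refine tendsto_iff_forall_lipschitz_integral_tendsto.2 fun f hfb ⟨L, hL⟩ => ?_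
  rw [Metric.tendsto_nhds]
  intro ε hε
  have h0 := total_pos s₀.2
  obtain ⟨δ, hδ, H⟩ := exists_coupling.{u} β hm₀ μ.nonneg (half_pos h0)
    (by positivity : 0 < ε / (2 * (L + 1)))
  have hc1 : Continuous fun s : Quadrant => total s := by unfold total; fun_prop
  have hc2 : Continuous fun s : Quadrant => distL1 s s₀ := by unfold distL1; fun_prop
  have e1 : ∀ᶠ s : Quadrant in 𝓝 s₀, total (s₀ : ℝ × ℝ) / 2 < total s :=
    hc1.continuousAt.eventually (lt_mem_nhds (half_lt_self h0))
  have e2 : ∀ᶠ s : Quadrant in 𝓝 s₀, distL1 s s₀ < δ :=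
    hc2.continuousAt.eventually (gt_mem_nhds (by simpa [distL1] using hδ))
  filter_upwards [e1, e2] with s hs1 hs2
  obtain ⟨Ω, _, P, Z, Z', _, hZm, hZm', hZ, hZ', hle⟩ := H μ ν μ ν hmean hm hmean hm s s.2 s₀ s₀.2
    hs1.le (half_le_self h0.le) (by simpa [dW_self] using hs2) (F s) (F s₀) (hF s) (hF s₀)
  have hfm := hL.continuous.measurable
  rw [← hZ, ← hZ', integral_map hZm.aemeasurable hfm.aestronglyMeasurable,
    integral_map hZm'.aemeasurable hfm.aestronglyMeasurable, Real.dist_eq]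
  obtain ⟨C, hC⟩ := isCompact_univ.exists_bound_of_continuousOn hL.continuous.continuousOn
  have hi : ∀ {Z : Ω → Set.Icc (0 : ℝ) 1}, Measurable Z → Integrable (fun ω => f (Z ω)) P :=
    fun hZ => Integrable.of_bound (hfm.comp hZ).aestronglyMeasurable C
      (ae_of_all _ fun _ => hC _ trivial)
  have hi' : Integrable (fun ω => |(Z ω : ℝ) - Z' ω|) P :=
    Integrable.of_bound (hZm.subtype_val.sub hZm'.subtype_val).abs.aestronglyMeasurable 1
      (ae_of_all _ fun ω => by
        rw [Real.norm_eq_abs, abs_abs, abs_le]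
        constructor <;> linarith [(Z ω).2.1, (Z ω).2.2, (Z' ω).2.1, (Z' ω).2.2])
  rw [← integral_sub (hi hZm) (hi hZm')]
  calc |∫ ω, (f (Z ω) - f (Z' ω)) ∂P| ≤ ∫ ω, |f (Z ω) - f (Z' ω)| ∂P :=
        abs_integral_le_integral_abs
    _ ≤ ∫ ω, L * |(Z ω : ℝ) - Z' ω| ∂P :=
        integral_mono ((hi hZm).sub (hi hZm')).abs (hi'.const_mul _) fun ω => hL.dist_le_mul _ _
    _ = L * ∫ ω, |(Z ω : ℝ) - Z' ω| ∂P := integral_const_mul _ _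
    _ ≤ L * (ε / (2 * (L + 1))) := by gcongr
    _ < ε := by
      rw [← mul_div_assoc, div_lt_iff₀ (by positivity)]
      nlinarith [L.coe_nonneg, mul_nonneg L.coe_nonneg hε.le]

lemma dTrunc_nonneg (n : ℕ) (G₁ G₂ : Maps) : 0 ≤ dTrunc n G₁ G₂ :=
  Real.iSup_nonneg fun _ => dW_nonneg _ _

/-- `dMaps` is small as soon as finitely many of the `dTrunc` are. -/
lemma exists_dMaps_lt {ε : ℝ} (hε : 0 < ε) :
    ∃ N : ℕ, ∀ G₁ G₂ : Maps, (∀ n < N, dTrunc (n + 1) G₁ G₂ ≤ ε / 4) → dMaps G₁ G₂ < ε := by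
  -- Each quotient is at most `1`, so the tail is at most `2⁻ᴺ < ε / 2`; the first `N` terms
  -- contribute at most `ε / 4` because the weights sum to `1`.
  obtain ⟨N, hN⟩ := exists_pow_lt_of_lt_one (half_pos hε) (by norm_num : (1 / 2 : ℝ) < 1)
  refine ⟨N, fun G₁ G₂ H => ?_⟩
  set b : ℕ → ℝ := fun n => dTrunc (n + 1) G₁ G₂ / (1 + dTrunc (n + 1) G₁ G₂)
  have hb0 : ∀ n, 0 ≤ b n := fun n => by
    have := dTrunc_nonneg (n + 1) G₁ G₂
    positivity
  have hb1 : ∀ n, b n ≤ 1 := fun n => by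
    have := dTrunc_nonneg (n + 1) G₁ G₂
    exact (div_le_one (by positivity)).2 (by linarith)
  have hbd : ∀ n < N, b n ≤ ε / 4 := fun n hn => by
    have := dTrunc_nonneg (n + 1) G₁ G₂
    exact (div_le_self this (by linarith)).trans (H n hn)
  have hgeo : HasSum (fun n : ℕ => 1 / (2 : ℝ) ^ (n + 1)) 1 := by
    have := hasSum_geometric_two' 1
    refine this.congr_fun fun n => ?_
    rw [pow_succ]; field_simp
  have hs : Summable fun n => 1 / (2 : ℝ) ^ (n + 1) * b n :=
    Summable.of_nonneg_of_le (fun n => mul_nonneg (by positivity) (hb0 n))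
      (fun n => mul_le_of_le_one_right (by positivity) (hb1 n)) hgeo.summable
  change ∑' n : ℕ, 1 / (2 : ℝ) ^ (n + 1) * b n < ε
  rw [← hs.sum_add_tsum_nat_add N]
  have h1 : ∑ n ∈ Finset.range N, 1 / (2 : ℝ) ^ (n + 1) * b n ≤ ε / 4 := by
    calc ∑ n ∈ Finset.range N, 1 / (2 : ℝ) ^ (n + 1) * b n
        ≤ ∑ n ∈ Finset.range N, 1 / (2 : ℝ) ^ (n + 1) * (ε / 4) :=
          Finset.sum_le_sum fun n hn => mul_le_mul_of_nonneg_left (hbd n (Finset.mem_range.1 hn))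
            (by positivity)
      _ = (∑ n ∈ Finset.range N, 1 / (2 : ℝ) ^ (n + 1)) * (ε / 4) := (Finset.sum_mul ..).symm
      _ ≤ 1 * (ε / 4) := by
          gcongr
          exact sum_le_hasSum _ (fun _ _ => by positivity) hgeo
      _ = ε / 4 := one_mul _
  have h2 : ∑' n : ℕ, 1 / (2 : ℝ) ^ (n + N + 1) * b (n + N) ≤ (1 / 2) ^ N := by
    have hg2 := hgeo.mul_left ((1 / 2 : ℝ) ^ N)
    rw [mul_one] at hg2
    rw [← hg2.tsum_eq]
    refine ((summable_nat_add_iff N).2 hs).tsum_le_tsum (fun n => ?_) hg2.summable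
    refine (mul_le_of_le_one_right (by positivity) (hb1 _)).trans_eq ?_
    rw [one_div_pow, one_div_mul_one_div, ← pow_add]
    congr 2
    ring
  linarith

end RRU

theorem mainTheorem5 (m₀ β : ℝ) (hm₀ : 0 < m₀) (hβ : m₀ ≤ β) :
    ∃ F : RRU.Params m₀ β → RRU.Maps,
      (∀ (p : RRU.Params m₀ β) (s : RRU.Quadrant),
        RRU.IsLimitLaw.{u} p.1.1 p.1.2 (s : ℝ × ℝ) (F p s)) ∧
      ∀ ε : ℝ, 0 < ε → ∃ δ : ℝ, 0 < δ ∧ ∀ p q : RRU.Params m₀ β,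
        RRU.dM p q < δ → RRU.dMaps (F p) (F q) < ε := by
  choose F₀ hF₀ using fun (p : RRU.Params m₀ β) (s : RRU.Quadrant) =>
    RRU.exists_isLimitLaw.{u} p.2.1 s.2
  refine ⟨fun p => ⟨F₀ p, RRU.continuous_of_isLimitLaw hm₀ p.2.1 p.2.2 (hF₀ p)⟩, hF₀,
    fun ε hε => ?_⟩
  obtain ⟨N, hN⟩ := RRU.exists_dMaps_lt hε
  -- Only the truncations at `1 / (n + 1)` with `n < N` matter, so `1 / (N + 1)` is a lower bound
  -- for the content at every relevant point, and one `δ` serves them all.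
  obtain ⟨δ, hδ, H⟩ := RRU.exists_coupling.{u} β hm₀ (hm₀.le.trans hβ)
    (by positivity : (0 : ℝ) < 1 / (N + 1)) (by positivity : 0 < ε / 4)
  refine ⟨δ, hδ, fun p q hpq => hN _ _ fun n hn => Real.iSup_le (fun s => ?_) (by positivity)⟩
  have hs : 1 / ((N : ℝ) + 1) ≤ RRU.total s.1 := by
    refine le_trans ?_ s.2
    rw [Nat.cast_add_one]
    gcongr
  obtain ⟨Ω, _, P, Z, Z', _, hZm, hZm', hZ, hZ', hle⟩ := H p.1.1 p.1.2 q.1.1 q.1.2 p.2.1 p.2.2 q.2.1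
    q.2.2 s.1 s.1.2 s.1 s.1.2 hs hs (by simpa [RRU.distL1, RRU.dM] using hpq) _ _ (hF₀ p s.1) (hF₀ q s.1)
  exact (RRU.dW_le_integral_abs_sub P hZm hZm' hZ hZ').trans hle
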